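/- \textbf{Definitions.} A \emph{Word-RAM with $w$-bit words} has registers and a memory whose cells hold $w$-bit words; a deterministic program is a finite list of instructions (arithmetic, bitwise operations and shifts, indirect load and store, comparisons with jumps, halt), each taking one unit of time. A decision problem \emph{requires $n^{e-o(1)}$ time} if for no $\varepsilon>0$ there is a deterministic program that decides it, on a Word-RAM with $O(\log n)$-bit words, in time $O(n^{e-\varepsilon})$ on all instances of size $n$. A $k$-\emph{hyperclique} in a $3$-uniform hypergraph is a set of $k$ vertices any three of which form a hyperedge. The \emph{3-uniform $k$-hyperclique hypothesis} says: for every integer $k\ge 3$, deciding whether a $3$-uniform hypergraph on $n$ vertices, given by its adjacency tensor, contains a $k$-hyperclique requires $n^{k-o(1)}$ time. A \emph{unary $d$-VASS} consists of a non-empty finite set $Q$ of states and a non-empty set $T\subseteq Q\times\{-1,0,1\}^d\times Q$ of transitions; its \emph{size} is $n=|Q|+|T|$. For $B\in\mathbb N$, a \emph{$B$-bounded run} is a sequence of configurations in $Q\times\{0,\dots,B\}^d$ in which each $(q',v')$ arises from its predecessor $(q,v)$ by a transition $(q,v'-v,q')\in T$. For a function $B(n)$, \emph{reachability in unary $(B(n),d)$-VASS}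 asks, given a unary $d$-VASS of size $n$ by the list of its transitions, and two configurations in $Q\times\{0,\dots,B(n)\}^d$, whether there is a $B(n)$-bounded run from the first to the second. \textbf{Theorem.} Assume the 3-uniform $k$-hyperclique hypothesis. Then for every integer $d\ge 0$ and every constant $\gamma>0$, reachability in linearly bounded, i.e. $(\lfloor\gamma n\rfloor, d+2)$-, unary VASS of size $n$ requires $n^{d-o(1)}$ time. (Equivalently, in dimension $d\ge 2$ it requires $n^{d-2-o(1)}$ time.) -/

import Mathlib

open Filter Asymptotics

/-! ### The Word-RAM

A Word-RAM with `w`-bit words has registers and a memory, each of whose cells holds a natural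
number below `2 ^ w`. A program is a finite list of instructions (so it names only finitely many
registers); every instruction costs one unit of time. An instruction whose result does not fit in
`w` bits cannot be executed. -/

namespace WordRAM

/-- The binary operations on words. Subtraction is truncated, `div` and `mod` are those of `ℕ`. -/
inductive Op where
  | add | sub | mul | div | mod | and | or | xor | shl | shr

def Op.eval : Op → ℕ → ℕ → ℕ
  | .add, a, b => a + b
  | .sub, a, b => a - b
  | .mul, a, b => a * b
  | .div, a, b => a / b
  | .mod, a, b => a % b
  | .and, a, b => a &&& b
  | .or, a, b => a ||| b
  | .xor, a, b => a ^^^ b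
  | .shl, a, b => a <<< b
  | .shr, a, b => a >>> b

inductive Instr where
  /-- `reg r := v` -/
  | const (r v : ℕ)
  /-- `reg r := o (reg a) (reg b)` -/
  | op (o : Op) (r a b : ℕ)
  /-- `reg r := mem (reg a)` -/
  | load (r a : ℕ)
  /-- `mem (reg a) := reg r` -/
  | store (a r : ℕ)
  /-- `goto l` -/
  | jump (l : ℕ)
  /-- `if reg a < reg b then goto l` -/
  | jumpLt (a b l : ℕ)
  /-- `if reg a = reg b then goto l` -/
  | jumpEq (a b l : ℕ)
  | halt

abbrev Program := List Instr

structure Config where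
  /-- index of the next instruction -/
  pc : ℕ
  reg : ℕ → ℕ
  mem : ℕ → ℕ

/-- Write the word `v` to register `r` and go to the next instruction, if `v` fits in `w` bits. -/
def Config.setReg (w : ℕ) (s : Config) (r v : ℕ) : Option Config :=
  if v < 2 ^ w then
    some { pc := s.pc + 1, reg := Function.update s.reg r v, mem := s.mem }
  else none

/-- Execute one instruction with `w`-bit words; `none` if the machine has halted, if the program
counter has left the program, or if the result overflows. -/
def step (w : ℕ) (P : Program) (s : Config) : Option Config :=
  match P[s.pc]? with
  | none => none
  | some (.const r v) => s.setReg w r v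
  | some (.op o r a b) => s.setReg w r (o.eval (s.reg a) (s.reg b))
  | some (.load r a) => s.setReg w r (s.mem (s.reg a))
  | some (.store a r) =>
      some { pc := s.pc + 1, reg := s.reg, mem := Function.update s.mem (s.reg a) (s.reg r) }
  | some (.jump l) => some { s with pc := l }
  | some (.jumpLt a b l) => some { s with pc := if s.reg a < s.reg b then l else s.pc + 1 }
  | some (.jumpEq a b l) => some { s with pc := if s.reg a = s.reg b then l else s.pc + 1 }
  | some .halt => none

/-- Execute exactly `t` instructions. -/
def steps (w : ℕ) (P : Program) : ℕ → Config → Option Config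
  | 0, s => some s
  | t + 1, s => (step w P s).bind (steps w P t)

/-- The input is stored in memory cells `0, 1, …`, its length in register `0`;
everything else is `0`. -/
def initial (input : List ℕ) : Config where
  pc := 0
  reg := fun r => if r = 0 then input.length else 0
  mem := fun i => input.getD i 0

/-- With `w`-bit words, and started on `input`, whose words have to fit in `w` bits, the program
executes `t` instructions, arrives at a `halt` instruction, and then register `0` contains
`out`. -/
def Outputs (w : ℕ) (P : Program) (input : List ℕ) (t out : ℕ) : Prop :=
  input.length < 2 ^ w ∧ (∀ a ∈ input, a < 2 ^ w) ∧
    ∃ s, steps w P t (initial input) = some s ∧ P[s.pc]? = some .halt ∧ s.reg 0 = out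

end WordRAM

/-- A decision problem whose instances have a size and an encoding as a list of words. -/
structure DecisionProblem where
  Instance : Type
  size : Instance → ℕ
  encode : Instance → List ℕ
  Yes : Instance → Prop

namespace DecisionProblem

/-- Some deterministic program decides `A` on a Word-RAM with `O(log n)`-bit words, in time at
most `T n` on all instances of size `n`. The answer is `1` for yes and `0` for no. -/
def DecidableInTime (A : DecisionProblem) (T : ℕ → ℕ) : Prop :=
  ∃ (P : WordRAM.Program) (c : ℕ), ∀ x : A.Instance,
    ∃ t ≤ T (A.size x), ∃ out,
      WordRAM.Outputs (c * (Nat.log 2 (A.size x) + 1)) P (A.encode x) t out ∧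
        (A.Yes x ∧ out = 1 ∨ ¬ A.Yes x ∧ out = 0)

/-- `A` requires `n ^ (e - o(1))` time: it is not decidable in time `O(n ^ (e - ε))`
for any `ε > 0`. -/
def RequiresTimePow (A : DecisionProblem) (e : ℝ) : Prop :=
  ∀ ε : ℝ, 0 < ε → ∀ T : ℕ → ℕ,
    (fun n : ℕ => (T n : ℝ)) =O[atTop] (fun n : ℕ => (n : ℝ) ^ (e - ε)) →
      ¬ A.DecidableInTime T

end DecisionProblem

/-! ### Hypergraphs and hypercliques -/

namespace Hypergraph

/-- Every hyperedge has cardinality `μ`. -/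
def IsUniform {V : Type} (H : Hypergraph V) (μ : ℕ) : Prop :=
  ∀ e ∈ H.edgeSet, e.Finite ∧ e.ncard = μ

/-- A `k`-hyperclique of a `μ`-uniform hypergraph: `k` vertices such that any `μ` of them form
a hyperedge. -/
def HasHyperclique {V : Type} (H : Hypergraph V) (μ k : ℕ) : Prop :=
  ∃ S : Finset V, (S : Set V) ⊆ H.vertexSet ∧ S.card = k ∧
    ∀ e : Finset V, e ⊆ S → e.card = μ → (e : Set V) ∈ H.edgeSet

open Classical in
/-- The input word list of a `3`-uniform hypergraph with vertices `0, …, n - 1`: `n`, then the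
`n ^ 3` entries of its adjacency tensor in lexicographic order. -/
noncomputable def encode3 {n : ℕ} (H : Hypergraph (Fin n)) : List ℕ :=
  n :: (List.finRange n).flatMap fun i => (List.finRange n).flatMap fun j =>
    (List.finRange n).map fun l => if ({i, j, l} : Set (Fin n)) ∈ H.edgeSet then 1 else 0

end Hypergraph

/-- A `3`-uniform hypergraph with vertex set `{0, …, n - 1}`. -/
structure Hypergraph3 where
  n : ℕ
  graph : Hypergraph (Fin n)
  vertexSet_eq : graph.vertexSet = Set.univ
  uniform : graph.IsUniform 3

/-- The problem of finding out whether a `3`-uniform hypergraph contains a `k`-hyperclique; the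
size of an instance is its number of vertices. -/
noncomputable def hypercliqueProblem (k : ℕ) : DecisionProblem where
  Instance := Hypergraph3
  size H := H.n
  encode H := H.graph.encode3
  Yes H := H.graph.HasHyperclique 3 k

/-- The `3`-uniform `k`-hyperclique hypothesis. -/
def HypercliqueHypothesis : Prop :=
  ∀ k : ℕ, 3 ≤ k → (hypercliqueProblem k).RequiresTimePow k

/-! ### Vector addition systems with states -/

/-- A `d`-dimensional vector addition system with states `Q`
(which is non-empty because there is a transition). -/
structure VASS (Q : Type) (d : ℕ) where
  trans : Finset (Q × (Fin d → ℤ) × Q)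
  trans_nonempty : trans.Nonempty

namespace VASS

variable {Q : Type} {d : ℕ}

/-- All updates are in `{-1, 0, 1} ^ d`. -/
def IsUnary (V : VASS Q d) : Prop :=
  ∀ t ∈ V.trans, ∀ i, t.2.1 i = -1 ∨ t.2.1 i = 0 ∨ t.2.1 i = 1

/-- The size `|Q| + |T|` of a unary VASS. -/
def unarySize [Fintype Q] (V : VASS Q d) : ℕ := Fintype.card Q + V.trans.card

/-- One step of the `B`-bounded VASS, between configurations in `Q × {0, …, B} ^ d`. -/
def BStep (V : VASS Q d) (B : ℕ) (c c' : Q × (Fin d → ℕ)) : Prop :=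
  (∀ i, c.2 i ≤ B) ∧ (∀ i, c'.2 i ≤ B) ∧
    ∃ x : Fin d → ℤ, (c.1, x, c'.1) ∈ V.trans ∧ ∀ i, (c'.2 i : ℤ) = (c.2 i : ℤ) + x i

/-- There is a run of the `B`-bounded VASS from one configuration to the other. -/
def BReach (V : VASS Q d) (B : ℕ) : Q × (Fin d → ℕ) → Q × (Fin d → ℕ) → Prop :=
  Relation.ReflTransGen (V.BStep B)

end VASS

/-- An instance of reachability in unary `(B(n), d)`-VASS: a unary `d`-VASS with states
`0, …, numStates - 1`, its transitions listed in any order, and an initial and a target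
configuration of the `B(n)`-bounded VASS, where `n` is the size of the VASS. -/
structure BoundedReachInstance (d : ℕ) (B : ℕ → ℕ) where
  numStates : ℕ
  vass : VASS (Fin numStates) d
  unary : vass.IsUnary
  transList : List (Fin numStates × (Fin d → ℤ) × Fin numStates)
  transList_nodup : transList.Nodup
  mem_transList : ∀ t, t ∈ transList ↔ t ∈ vass.trans
  source : Fin numStates × (Fin d → ℕ)
  target : Fin numStates × (Fin d → ℕ)
  source_le : ∀ i, source.2 i ≤ B vass.unarySize
  target_le : ∀ i, target.2 i ≤ B vass.unarySize

namespace BoundedReachInstance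

variable {d : ℕ} {B : ℕ → ℕ}

/-- The input word list: the numbers of states and of transitions, the initial and the target
configuration, and then each transition `(p, x, q)` as `p, x₁ + 1, …, x_d + 1, q`. -/
def encode (I : BoundedReachInstance d B) : List ℕ :=
  [I.numStates, I.transList.length] ++
    (I.source.1.val :: List.ofFn I.source.2) ++ (I.target.1.val :: List.ofFn I.target.2) ++
      I.transList.flatMap fun t =>
        t.1.val :: ((List.ofFn fun i => (t.2.1 i + 1).toNat) ++ [t.2.2.val])

end BoundedReachInstance

/-- Reachability in unary `(B(n), d)`-VASS of size `n`. The function `B` belongs to the problem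
and is not part of the input. -/
def boundedReachability (d : ℕ) (B : ℕ → ℕ) : DecisionProblem where
  Instance := BoundedReachInstance d B
  size I := I.vass.unarySize
  encode I := I.encode
  Yes I := I.vass.BReach (B I.vass.unarySize) I.source I.target

/-!
A choice of `d * K` vertices among `N` is encoded in `d` counters, each of which holds `K` digits
to the base `N`. To check that a triple of them is a hyperedge, the VASS guesses an entry `1` of
the adjacency tensor and compares it with the digits of one counter after another: it empties the
counter, while the state remembers the guess and what has been subtracted, and fills it again. There
are `N ^ (K + 3)` such states for each counter of each triple.

One further counter replaces the zero tests. It counts every unit that is subtracted during the `R`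
checks, so that it is at most `R` times the sum of the counters, with equality only if each counter
was emptied in each check. At the end, the VASS trades one unit of a counter for `R` units of the
sum, and it reaches the zero vector only in the case of equality.

Thus `n` is of order `N ^ (K + 3)`, while the counters stay below a multiple of `N ^ K`, and time
`n ^ (d - ε)` for reachability means time `N ^ ((K + 3) * (d - ε)) ≤ N ^ (d * K - 1)` for
hypercliques with `d * K` vertices if `K` is large. For `d ≤ 1` the claim holds because a program
has to read its input.
-/

/-! ### Running programs -/

namespace WordRAM

variable {w w' : ℕ} {P : Program} {s s' : Config}

theorem steps_one : steps w P 1 s = step w P s := by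
  simp only [steps, Option.bind_fun_some]

theorem steps_add (a b : ℕ) : steps w P (a + b) s = (steps w P a s).bind (steps w P b) := by
  induction a generalizing s with
  | zero => simp [steps]
  | succ a ih => simp only [Nat.succ_add, steps, ih, Option.bind_assoc]

theorem steps_trans {a b : ℕ} {s'' : Config} (h : steps w P a s = some s')
    (h' : steps w P b s' = some s'') : steps w P (a + b) s = some s'' := by
  rw [steps_add, h, Option.bind_some, h']

theorem steps_trans_step {a : ℕ} {s'' : Config} (h : steps w P a s = some s')
    (h' : step w P s' = some s'') : steps w P (a + 1) s = some s'' :=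
  steps_trans h (steps_one.trans h')

theorem steps_of_step {P' : Program} {f : Config → Config}
    (h : ∀ s s', step w P s = some s' → step w' P' (f s) = some (f s')) {t : ℕ}
    (hs : steps w P t s = some s') : steps w' P' t (f s) = some (f s') := by
  induction t generalizing s with
  | zero => cases hs; rfl
  | succ t ih =>
    obtain ⟨s₁, h₁, h₂⟩ := Option.bind_eq_some_iff.1 hs
    exact Option.bind_eq_some_iff.2 ⟨f s₁, h _ _ h₁, ih h₂⟩

theorem setReg_eq_some_iff {r v : ℕ} : s.setReg w r v = some s' ↔
    v < 2 ^ w ∧ { pc := s.pc + 1, reg := Function.update s.reg r v, mem := s.mem } = s' := by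
  simp only [Config.setReg, Option.ite_none_right_eq_some, Option.some.injEq]

/-- The effect of a single instruction, wherever it stands in a program. -/
def Instr.exec (w : ℕ) (s : Config) : Instr → Option Config
  | .const r v => s.setReg w r v
  | .op o r a b => s.setReg w r (o.eval (s.reg a) (s.reg b))
  | .load r a => s.setReg w r (s.mem (s.reg a))
  | .store a r =>
      some { pc := s.pc + 1, reg := s.reg, mem := Function.update s.mem (s.reg a) (s.reg r) }
  | .jump l => some { s with pc := l }
  | .jumpLt a b l => some { s with pc := if s.reg a < s.reg b then l else s.pc + 1 }
  | .jumpEq a b l => some { s with pc := if s.reg a = s.reg b then l else s.pc + 1 }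
  | .halt => none

theorem step_eq_bind : step w P s = P[s.pc]?.bind (Instr.exec w s) := by
  unfold step
  rcases P[s.pc]? with _ | _ | _ <;> rfl

theorem step_eq_some_iff :
    step w P s = some s' ↔ ∃ i, P[s.pc]? = some i ∧ i.exec w s = some s' := by
  rw [step_eq_bind, Option.bind_eq_some_iff]

theorem step_eq_none_of_halt (h : P[s.pc]? = some .halt) : step w P s = none := by
  rw [step_eq_bind, h]; rfl

theorem steps_halt_unique {t t' : ℕ} {s₁ s₂ : Config} (h₁ : steps w P t s = some s₁)
    (h₂ : steps w P t' s = some s₂) (halt₁ : P[s₁.pc]? = some .halt)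
    (halt₂ : P[s₂.pc]? = some .halt) : s₁ = s₂ := by
  wlog htt' : t ≤ t' generalizing t t' s₁ s₂
  · exact (this h₂ h₁ halt₂ halt₁ (by omega)).symm
  obtain ⟨k, rfl⟩ := Nat.exists_eq_add_of_le htt'
  rw [steps_add, h₁, Option.bind_some] at h₂
  cases k with
  | zero => exact Option.some.inj h₂
  | succ k => simp [steps, step_eq_none_of_halt halt₁] at h₂

/-! ### Composing programs -/

theorem Instr.exec_mono (hw : w ≤ w') (i : Instr) (h : i.exec w s = some s') :
    i.exec w' s = some s' := by
  have hpow : 2 ^ w ≤ 2 ^ w' := Nat.pow_le_pow_right two_pos hw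
  cases i with
  | const | op | load =>
    obtain ⟨hlt, rfl⟩ := setReg_eq_some_iff.1 h
    exact setReg_eq_some_iff.2 ⟨hlt.trans_le hpow, rfl⟩
  | _ => exact h

theorem step_append_of_le (hw : w ≤ w') (P X : Program) (s s' : Config)
    (h : step w P s = some s') : step w' (P ++ X) s = some s' := by
  obtain ⟨i, hi, hex⟩ := step_eq_some_iff.1 h
  have hlt : s.pc < P.length := (List.getElem?_eq_some_iff.1 hi).1
  exact step_eq_some_iff.2 ⟨i, by rw [List.getElem?_append_left hlt, hi], i.exec_mono hw hex⟩

theorem steps_append_of_le (hw : w ≤ w') (X : Program) {t : ℕ} (h : steps w P t s = some s') :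
    steps w' (P ++ X) t s = some s' :=
  steps_of_step (f := id) (step_append_of_le hw P X) h

/-- The instruction with its jump targets moved by `k`, for use in a program that starts at
position `k` of a longer one. -/
def Instr.shift (k : ℕ) : Instr → Instr
  | .jump l => .jump (k + l)
  | .jumpLt a b l => .jumpLt a b (k + l)
  | .jumpEq a b l => .jumpEq a b (k + l)
  | i => i

/-- The configuration of a program that starts at position `k` of a longer one. -/
def Config.shift (k : ℕ) (s : Config) : Config := { s with pc := k + s.pc }

theorem Instr.exec_shift (k : ℕ) (i : Instr) (h : i.exec w s = some s') :
    (i.shift k).exec w (s.shift k) = some (s'.shift k) := by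
  cases i with
  | const | op | load =>
    obtain ⟨hlt, rfl⟩ := setReg_eq_some_iff.1 h
    exact setReg_eq_some_iff.2 ⟨hlt, rfl⟩
  | halt => cases h
  | store | jump => cases h; rfl
  | jumpLt | jumpEq =>
    cases h
    simp only [Instr.shift, Instr.exec, Config.shift, Nat.add_assoc, apply_ite (k + ·)]

theorem getElem?_append_map_shift (A P : Program) (i : ℕ) :
    (A ++ P.map (Instr.shift A.length))[A.length + i]? = (P[i]?).map (Instr.shift A.length) := by
  rw [List.getElem?_append_right (Nat.le_add_right _ _), List.getElem?_map, Nat.add_sub_cancel_left]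

theorem steps_shift (A : Program) {t : ℕ} (h : steps w P t s = some s') :
    steps w (A ++ P.map (Instr.shift A.length)) t (s.shift A.length) =
      some (s'.shift A.length) := by
  refine steps_of_step (f := Config.shift A.length) (fun s s' h => ?_) h
  obtain ⟨i, hi, hex⟩ := step_eq_some_iff.1 h
  refine step_eq_some_iff.2 ⟨i.shift A.length, ?_, i.exec_shift _ hex⟩
  simp only [Config.shift, getElem?_append_map_shift, hi, Option.map_some]

theorem Outputs.comp {A : Program} {inp inp' : List ℕ} {t t' out : ℕ} (hw : w' ≤ w)
    (hlen : inp.length < 2 ^ w) (hinp : ∀ a ∈ inp, a < 2 ^ w)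
    (hA : steps w A t (initial inp) = some { initial inp' with pc := A.length })
    (hP : Outputs w' P inp' t' out) :
    Outputs w (A ++ P.map (Instr.shift A.length)) inp (t + t') out := by
  obtain ⟨-, -, s, hs, hhalt, hout⟩ := hP
  have hs : steps w P t' (initial inp') = some s := by
    simpa only [List.append_nil] using steps_append_of_le hw [] hs
  refine ⟨hlen, hinp, s.shift A.length,
    steps_trans (steps_append_of_le le_rfl _ hA) (steps_shift A hs), ?_, hout⟩
  simp only [Config.shift, getElem?_append_map_shift, hhalt, Option.map_some, Instr.shift]

/-! ### Registers that a program leaves alone -/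

/-- The register that an instruction writes to, if any. -/
def Instr.writes : Instr → Option ℕ
  | .const r _ | .op _ r _ _ | .load r _ => some r
  | _ => none

theorem Instr.exec_reg_of_writes_ne {q : ℕ} (i : Instr) (hq : i.writes ≠ some q)
    (h : i.exec w s = some s') : s'.reg q = s.reg q := by
  cases i with
  | const | op | load =>
    obtain ⟨-, rfl⟩ := setReg_eq_some_iff.1 h
    exact Function.update_of_ne (fun hr => hq (congrArg some hr.symm)) _ _
  | halt => cases h
  | store | jump | jumpLt | jumpEq => cases h; rfl

theorem steps_reg_of_writes_ne {t q : ℕ} (hq : ∀ i ∈ P, i.writes ≠ some q)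
    (h : steps w P t s = some s') : s'.reg q = s.reg q := by
  induction t generalizing s with
  | zero => cases h; rfl
  | succ t ih =>
    obtain ⟨s₁, h₁, h₂⟩ := Option.bind_eq_some_iff.1 h
    obtain ⟨i, hi, hex⟩ := step_eq_some_iff.1 h₁
    exact (ih h₂).trans (i.exec_reg_of_writes_ne (hq i (List.mem_of_getElem? hi)) hex)

theorem exists_forall_writes_lt (P : Program) :
    ∃ m, ∀ i ∈ P, ∀ r, i.writes = some r → r < m := by
  obtain ⟨m, hm⟩ := (P.finite_toSet.image fun i => i.writes.getD 0).bddAbove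
  refine ⟨m + 1, fun i hi r hr => ?_⟩
  have hle : i.writes.getD 0 ≤ m := hm ⟨i, hi, rfl⟩
  rw [hr, Option.getD_some] at hle
  omega

end WordRAM
/-! ### Straight-line code -/

namespace WordRAM

/-- The program `P` contains `code` from position `a` on. -/
def CodeAt (P : Program) (a : ℕ) (code : Program) : Prop :=
  ∃ l r, P = l ++ (code ++ r) ∧ l.length = a

section CodeAt

variable {P c c' : Program} {a : ℕ}

theorem CodeAt.left (h : CodeAt P a (c ++ c')) : CodeAt P a c := by
  obtain ⟨l, r, rfl, rfl⟩ := h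
  exact ⟨l, c' ++ r, by simp only [List.append_assoc], rfl⟩

theorem CodeAt.right (h : CodeAt P a (c ++ c')) : CodeAt P (a + c.length) c' := by
  obtain ⟨l, r, rfl, rfl⟩ := h
  exact ⟨l ++ c, r, by simp only [List.append_assoc], List.length_append⟩

theorem CodeAt.step_eq {w : ℕ} {i : Instr} {s : Config} (h : CodeAt P s.pc (i :: c)) :
    step w P s = i.exec w s := by
  obtain ⟨l, r, rfl, hl⟩ := h
  simp [step_eq_bind, ← hl]

end CodeAt

/-- The operations available in expressions, namely those with results of polynomial size. -/
inductive ArithOp where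
  | add | sub | mul | div | mod

/-- The instruction set's version of an operation of expressions. -/
def ArithOp.toOp : ArithOp → Op
  | .add => .add
  | .sub => .sub
  | .mul => .mul
  | .div => .div
  | .mod => .mod

theorem ArithOp.eval_succ_le (o : ArithOp) (a b : ℕ) :
    o.toOp.eval a b + 1 ≤ (a + 1) * (b + 1) := by
  cases o with
  | add | mul => simp only [toOp, Op.eval]; nlinarith [Nat.zero_le (a * b)]
  | sub => exact (Nat.succ_le_succ (Nat.sub_le a b)).trans (Nat.le_mul_of_pos_right _ b.succ_pos)
  | div =>
    exact (Nat.succ_le_succ (Nat.div_le_self a b)).trans (Nat.le_mul_of_pos_right _ b.succ_pos)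
  | mod => exact (Nat.succ_le_succ (Nat.mod_le a b)).trans (Nat.le_mul_of_pos_right _ b.succ_pos)

/-- Arithmetic expressions in five variables; variable `v` lives in register `v`. -/
inductive Expr where
  | var (v : Fin 5)
  | lit (n : ℕ)
  | bin (o : ArithOp) (a b : Expr)

namespace Expr

instance : NatCast Expr := ⟨lit⟩
instance : Zero Expr := ⟨lit 0⟩
instance : One Expr := ⟨lit 1⟩
instance : Add Expr := ⟨bin .add⟩
instance : Sub Expr := ⟨bin .sub⟩
instance : Mul Expr := ⟨bin .mul⟩
instance : Div Expr := ⟨bin .div⟩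
instance : Mod Expr := ⟨bin .mod⟩
instance : Pow Expr ℕ := ⟨fun e n => n.rec 1 fun _ p => p * e⟩

/-- The value of an expression, given those of the variables. -/
def eval (ρ : Fin 5 → ℕ) : Expr → ℕ
  | var v => ρ v
  | lit n => n
  | bin o a b => o.toOp.eval (a.eval ρ) (b.eval ρ)

section eval

variable (ρ : Fin 5 → ℕ) (a b : Expr)

@[simp] theorem eval_var (v : Fin 5) : (var v).eval ρ = ρ v := rfl
@[simp] theorem eval_natCast (n : ℕ) : (n : Expr).eval ρ = n := rfl
@[simp] theorem eval_zero : (0 : Expr).eval ρ = 0 := rfl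
@[simp] theorem eval_one : (1 : Expr).eval ρ = 1 := rfl
@[simp] theorem eval_add : (a + b).eval ρ = a.eval ρ + b.eval ρ := rfl
@[simp] theorem eval_sub : (a - b).eval ρ = a.eval ρ - b.eval ρ := rfl
@[simp] theorem eval_mul : (a * b).eval ρ = a.eval ρ * b.eval ρ := rfl
@[simp] theorem eval_div : (a / b).eval ρ = a.eval ρ / b.eval ρ := rfl
@[simp] theorem eval_mod : (a % b).eval ρ = a.eval ρ % b.eval ρ := rfl

@[simp] theorem eval_pow (n : ℕ) : (a ^ n).eval ρ = a.eval ρ ^ n := by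
  induction n with
  | zero => rfl
  | succ n ih => rw [pow_succ, ← ih]; rfl

end eval

/-- A bound for the exponent with which the value of an expression grows with its variables; the
literal `n` is counted as `2 ^ n`. -/
def deg : Expr → ℕ
  | var _ => 1
  | lit n => n
  | bin _ a b => a.deg + b.deg

section deg

variable (a b : Expr)

@[simp] theorem deg_var (v : Fin 5) : (var v).deg = 1 := rfl
@[simp] theorem deg_natCast (n : ℕ) : (n : Expr).deg = n := rfl
@[simp] theorem deg_zero : (0 : Expr).deg = 0 := rfl
@[simp] theorem deg_one : (1 : Expr).deg = 1 := rfl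
@[simp] theorem deg_add : (a + b).deg = a.deg + b.deg := rfl
@[simp] theorem deg_sub : (a - b).deg = a.deg + b.deg := rfl
@[simp] theorem deg_mul : (a * b).deg = a.deg + b.deg := rfl
@[simp] theorem deg_mod : (a % b).deg = a.deg + b.deg := rfl

@[simp] theorem deg_pow (n : ℕ) : (a ^ n).deg = 1 + n * a.deg := by
  induction n with
  | zero => rw [zero_mul]; rfl
  | succ n ih => rw [Nat.succ_mul, ← add_assoc, ← ih]; rfl

end deg

/-- All the intermediate results in the evaluation of an expression fit in `w` bits. -/
def Fits (w : ℕ) (ρ : Fin 5 → ℕ) : Expr → Prop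
  | var v => ρ v < 2 ^ w
  | lit n => n < 2 ^ w
  | bin o a b => a.Fits w ρ ∧ b.Fits w ρ ∧ (bin o a b).eval ρ < 2 ^ w

variable {w U : ℕ} {ρ : Fin 5 → ℕ} {e : Expr}

theorem Fits.eval_lt (h : e.Fits w ρ) : e.eval ρ < 2 ^ w := by
  cases e with
  | var | lit => exact h
  | bin => exact h.2.2

theorem eval_lt_pow_deg (hU : 2 ≤ U) (hρ : ∀ v, ρ v < U) (e : Expr) : e.eval ρ < U ^ e.deg := by
  induction e with
  | var v => simpa only [eval_var, deg_var, pow_one] using hρ v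
  | lit n => exact Nat.lt_pow_self hU
  | bin o a b iha ihb =>
    rw [deg, pow_add]
    exact (o.eval_succ_le _ _).trans (Nat.mul_le_mul iha ihb)

theorem fits_of_pow_deg_le (hU : 2 ≤ U) (hρ : ∀ v, ρ v < U) (he : U ^ e.deg ≤ 2 ^ w) :
    e.Fits w ρ := by
  have hlt : e.eval ρ < 2 ^ w := (eval_lt_pow_deg hU hρ e).trans_le he
  induction e with
  | var | lit => exact hlt
  | bin o a b iha ihb =>
    have ha : U ^ a.deg ≤ 2 ^ w := (Nat.pow_le_pow_right (by omega) (by simp [deg])).trans he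
    have hb : U ^ b.deg ≤ 2 ^ w := (Nat.pow_le_pow_right (by omega) (by simp [deg])).trans he
    exact ⟨iha ha ((eval_lt_pow_deg hU hρ a).trans_le ha),
      ihb hb ((eval_lt_pow_deg hU hρ b).trans_le hb), hlt⟩

/-- Code that computes the value of an expression in register `t`, using the registers from `t`
on. -/
def code : Expr → ℕ → Program
  | var v, t => [.op .and t v.val v.val]
  | lit n, t => [.const t n]
  | bin o a b, t => a.code t ++ (b.code (t + 1) ++ [.op o.toOp t t (t + 1)])

theorem exists_steps_code (he : e.Fits w ρ) {P : Program} {t : ℕ} (ht : 5 ≤ t) {s : Config}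
    (hP : CodeAt P s.pc (e.code t)) (hs : ∀ v : Fin 5, s.reg v.val = ρ v) :
    ∃ s', steps w P (e.code t).length s = some s' ∧ s'.pc = s.pc + (e.code t).length ∧
      s'.reg t = e.eval ρ ∧ (∀ r < t, s'.reg r = s.reg r) ∧ s'.mem = s.mem := by
  induction e generalizing t s with
  | var v =>
    refine ⟨_, steps_one.trans (hP.step_eq.trans (setReg_eq_some_iff.2 ⟨?_, rfl⟩)), rfl, ?_,
      fun r hr => Function.update_of_ne hr.ne _ _, rfl⟩ <;>
    simp only [Op.eval, Nat.and_self, hs, Function.update_self, eval_var]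
    exact he
  | lit n =>
    exact ⟨_, steps_one.trans (hP.step_eq.trans (setReg_eq_some_iff.2 ⟨he, rfl⟩)), rfl,
      Function.update_self .., fun r hr => Function.update_of_ne hr.ne _ _, rfl⟩
  | bin o a b iha ihb =>
    obtain ⟨s₁, h₁, hpc₁, hv₁, hr₁, hm₁⟩ := iha he.1 ht hP.left hs
    have hP₁ := hpc₁ ▸ hP.right
    obtain ⟨s₂, h₂, hpc₂, hv₂, hr₂, hm₂⟩ := ihb he.2.1 (t := t + 1) (by omega) hP₁.left
      fun v => by rw [hr₁ _ (by have := v.isLt; omega), hs]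
    have hP₂ := hpc₂ ▸ hP₁.right
    have hval : o.toOp.eval (s₂.reg t) (s₂.reg (t + 1)) = (bin o a b).eval ρ := by
      rw [hv₂, hr₂ t (by omega), hv₁, eval]
    simp only [code, List.length_append, List.length_singleton]
    refine ⟨_, steps_trans h₁ (steps_trans_step h₂ (hP₂.step_eq.trans
      (setReg_eq_some_iff.2 ⟨hval ▸ he.2.2, rfl⟩))), ?_, ?_, fun r hr => ?_, hm₂.trans hm₁⟩
    · simp only [hpc₂, hpc₁, add_assoc]
    · exact (Function.update_self ..).trans hval
    · exact (Function.update_of_ne hr.ne _ _).trans ((hr₂ r (by omega)).trans (hr₁ r hr))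

end Expr

/-- The configuration `s` is at position `a`, with the values `ρ` of the variables. -/
structure At (s : Config) (a : ℕ) (ρ : Fin 5 → ℕ) (mem : ℕ → ℕ) : Prop where
  pc_eq : s.pc = a
  reg_eq : ∀ v : Fin 5, s.reg v.val = ρ v
  mem_eq : s.mem = mem

/-- From every configuration of the first kind, `t` instructions lead to one of the second. -/
def Leads (w : ℕ) (P : Program) (t : ℕ) (a : ℕ) (ρ : Fin 5 → ℕ) (mem : ℕ → ℕ)
    (a' : ℕ) (ρ' : Fin 5 → ℕ) (mem' : ℕ → ℕ) : Prop :=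
  ∀ s, At s a ρ mem → ∃ s', steps w P t s = some s' ∧ At s' a' ρ' mem'

section Leads

variable {w t t' a a' a'' : ℕ} {P c c' : Program} {ρ ρ' ρ'' : Fin 5 → ℕ} {mem mem' mem'' : ℕ → ℕ}

theorem Leads.trans (h : Leads w P t a ρ mem a' ρ' mem')
    (h' : Leads w P t' a' ρ' mem' a'' ρ'' mem'') :
    Leads w P (t + t') a ρ mem a'' ρ'' mem'' := by
  intro s hs
  obtain ⟨s₁, h₁, hs₁⟩ := h s hs
  obtain ⟨s₂, h₂, hs₂⟩ := h' s₁ hs₁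
  exact ⟨s₂, steps_trans h₁ h₂, hs₂⟩

theorem leads_jump {l : ℕ} (hP : CodeAt P a [.jump l]) : Leads w P 1 a ρ mem l ρ mem := by
  rintro s ⟨rfl, hr, hm⟩
  exact ⟨_, steps_one.trans hP.step_eq, rfl, hr, hm⟩

theorem leads_jumpEq {u v : Fin 5} {l : ℕ} (hP : CodeAt P a [.jumpEq u v l]) :
    Leads w P 1 a ρ mem (if ρ u = ρ v then l else a + 1) ρ mem := by
  rintro s ⟨rfl, hr, hm⟩
  exact ⟨_, steps_one.trans hP.step_eq, by simp only [hr], hr, hm⟩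

/-- From position `a`, the straight-line code `c` transforms the variables and the memory in the
given way. -/
def Effect (w : ℕ) (c : Program) (ρ : Fin 5 → ℕ) (mem : ℕ → ℕ) (ρ' : Fin 5 → ℕ)
    (mem' : ℕ → ℕ) : Prop :=
  ∀ P a, CodeAt P a c → Leads w P c.length a ρ mem (a + c.length) ρ' mem'

theorem Effect.append (h : Effect w c ρ mem ρ' mem') (h' : Effect w c' ρ' mem' ρ'' mem'') :
    Effect w (c ++ c') ρ mem ρ'' mem'' := by
  intro P a hP
  rw [List.length_append, ← add_assoc]
  exact (h P a hP.left).trans (h' P _ hP.right)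

theorem effect_nil : Effect w [] ρ mem ρ mem := fun _ _ _ s hs => ⟨s, rfl, hs⟩

theorem At.update (v : Fin 5) (x : ℕ) {r : ℕ → ℕ} (hr : ∀ v : Fin 5, r v.val = ρ v) :
    At { pc := a, reg := Function.update r v.val x, mem := mem } a (Function.update ρ v x) mem where
  pc_eq := rfl
  reg_eq u := by
    by_cases huv : u = v
    · simp only [huv, Function.update_self]
    · simp only [Function.update_of_ne huv, Function.update_of_ne (Fin.val_ne_of_ne huv), hr]
  mem_eq := rfl

/-- Code for `variable := expression`. -/
def assign (v : Fin 5) (e : Expr) : Program := e.code 5 ++ [.op .and v.val 5 5]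

theorem effect_assign (v : Fin 5) {e : Expr} (he : e.Fits w ρ) :
    Effect w (assign v e) ρ mem (Function.update ρ v (e.eval ρ)) mem := by
  rintro P a hP s ⟨rfl, hr, rfl⟩
  obtain ⟨s₁, h₁, hpc₁, hv₁, hr₁, hm₁⟩ := e.exists_steps_code he le_rfl hP.left hr
  simp only [assign, List.length_append, List.length_singleton]
  refine ⟨_, steps_trans_step h₁ ((hpc₁ ▸ hP.right).step_eq.trans
    (setReg_eq_some_iff.2 ⟨?_, rfl⟩)), ?_⟩
  all_goals simp only [Op.eval, Nat.and_self, hv₁, hm₁, hpc₁, add_assoc]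
  exacts [At.update v _ fun u => (hr₁ u u.isLt).trans (hr u), he.eval_lt]

/-- Code for `variable := memory cell`. -/
def fetch (v : Fin 5) (e : Expr) : Program := e.code 5 ++ [.load v.val 5]

theorem effect_fetch (v : Fin 5) {e : Expr} (he : e.Fits w ρ) (hm : mem (e.eval ρ) < 2 ^ w) :
    Effect w (fetch v e) ρ mem (Function.update ρ v (mem (e.eval ρ))) mem := by
  rintro P a hP s ⟨rfl, hr, rfl⟩
  obtain ⟨s₁, h₁, hpc₁, hv₁, hr₁, hm₁⟩ := e.exists_steps_code he le_rfl hP.left hr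
  simp only [fetch, List.length_append, List.length_singleton]
  refine ⟨_, steps_trans_step h₁ ((hpc₁ ▸ hP.right).step_eq.trans
    (setReg_eq_some_iff.2 ⟨?_, rfl⟩)), ?_⟩
  all_goals simp only [hv₁, hm₁, hpc₁, add_assoc]
  exacts [At.update v _ fun u => (hr₁ u u.isLt).trans (hr u), hm]

/-- Code for `memory cell := expression`. -/
def put (e e' : Expr) : Program := e.code 5 ++ (e'.code 6 ++ [.store 5 6])

theorem effect_put {e e' : Expr} (he : e.Fits w ρ) (he' : e'.Fits w ρ) :
    Effect w (put e e') ρ mem ρ (Function.update mem (e.eval ρ) (e'.eval ρ)) := by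
  rintro P a hP s ⟨rfl, hr, rfl⟩
  obtain ⟨s₁, h₁, hpc₁, hv₁, hr₁, hm₁⟩ := e.exists_steps_code he le_rfl hP.left hr
  have hP₁ := hpc₁ ▸ hP.right
  obtain ⟨s₂, h₂, hpc₂, hv₂, hr₂, hm₂⟩ := e'.exists_steps_code he' (t := 6) (by norm_num) hP₁.left
    fun v => (hr₁ v v.isLt).trans (hr v)
  have hP₂ := hpc₂ ▸ hP₁.right
  simp only [put, List.length_append, List.length_singleton]
  refine ⟨_, steps_trans h₁ (steps_trans_step h₂ hP₂.step_eq), ?_,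
    fun v => (hr₂ v (by have := v.isLt; omega)).trans ((hr₁ v v.isLt).trans (hr v)), ?_⟩
  · simp only [hpc₂, hpc₁, add_assoc]
  · change Function.update s₂.mem (s₂.reg 5) (s₂.reg 6) = _
    rw [hv₂, hr₂ 5 (by norm_num), hv₁, hm₂, hm₁]

/-- The memory after writing a list of words from address `a` on. -/
def writeList (mem : ℕ → ℕ) (a : ℕ) (l : List ℕ) : ℕ → ℕ := fun x =>
  if a ≤ x ∧ x < a + l.length then l.getD (x - a) 0 else mem x

theorem writeList_nil (mem : ℕ → ℕ) (a : ℕ) : writeList mem a [] = mem :=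
  funext fun _ => if_neg (by rw [List.length_nil]; omega)

theorem writeList_cons (mem : ℕ → ℕ) (a v : ℕ) (l : List ℕ) :
    writeList mem a (v :: l) = writeList (Function.update mem a v) (a + 1) l := by
  funext x
  simp only [writeList, List.length_cons]
  rcases lt_trichotomy x a with h | rfl | h
  · rw [if_neg (by omega), if_neg (by omega), Function.update_of_ne (by omega)]
  · rw [if_pos (by omega), if_neg (by omega), Nat.sub_self, Function.update_self,
      List.getD_cons_zero]
  · obtain ⟨y, rfl⟩ := Nat.exists_eq_add_of_lt h
    rw [Function.update_of_ne (by omega), show a + y + 1 - a = y + 1 by omega,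
      show a + y + 1 - (a + 1) = y by omega, List.getD_cons_succ]
    exact if_congr (by omega) rfl rfl

/-- Code that writes the values of a list of expressions to consecutive memory cells. -/
def emit (e : Expr) : ℕ → List Expr → Program
  | _, [] => []
  | k, f :: l => put (e + k) f ++ emit e (k + 1) l

theorem effect_emit {e : Expr} {l : List Expr} {k : ℕ}
    (he : ∀ j < k + l.length, (e + j).Fits w ρ) (hl : ∀ f ∈ l, f.Fits w ρ) :
    Effect w (emit e k l) ρ mem ρ (writeList mem (e.eval ρ + k) (l.map (Expr.eval ρ))) := by
  induction l generalizing k mem with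
  | nil => rw [List.map_nil, writeList_nil]; exact effect_nil
  | cons f l ih =>
    rw [List.length_cons] at he
    rw [List.map_cons, writeList_cons]
    exact (effect_put (he k (by omega)) (hl f List.mem_cons_self)).append
      (ih (fun j hj => he j (by omega)) fun g hg => hl g (List.mem_cons_of_mem f hg))

end Leads

/-- Code that clears the registers `1, …, m`. -/
def clear : ℕ → Program
  | 0 => []
  | m + 1 => clear m ++ [.const (m + 1) 0]

theorem length_clear (m : ℕ) : (clear m).length = m := by
  induction m with
  | zero => rfl
  | succ m ih => rw [clear, List.length_append, ih, List.length_singleton]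

theorem steps_clear {w : ℕ} {P : Program} (m : ℕ) {s : Config} (hP : CodeAt P s.pc (clear m)) :
    steps w P m s =
      some { pc := s.pc + m, reg := fun r => if 1 ≤ r ∧ r ≤ m then 0 else s.reg r,
             mem := s.mem } := by
  induction m with
  | zero =>
    have hreg : (fun r => if 1 ≤ r ∧ r ≤ 0 then 0 else s.reg r) = s.reg :=
      funext fun r => if_neg (by omega)
    rw [hreg]; rfl
  | succ m ih =>
    have hP' : CodeAt P (s.pc + m) [.const (m + 1) 0] := by
      simpa only [length_clear] using hP.right
    refine steps_trans_step (ih hP.left) (Eq.trans (CodeAt.step_eq (i := .const (m + 1) 0) hP')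
      (setReg_eq_some_iff.2 ⟨by positivity, ?_⟩))
    simp only [Config.mk.injEq, and_true, add_assoc, true_and]
    funext r
    rcases eq_or_ne r (m + 1) with rfl | hr
    · simp
    · rw [Function.update_of_ne hr]
      exact if_congr (by omega) rfl rfl

end WordRAM
/-! ### Programs that rewrite their input block by block -/

section EqualBlocks

variable {α β : Type*} {f : β → List α} {len : ℕ}

theorem length_flatMap_of_forall_length_eq (l : List β) (h : ∀ i, (f i).length = len) :
    (l.flatMap f).length = l.length * len := by
  simp only [List.length_flatMap, h, List.map_const', List.sum_replicate, smul_eq_mul]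

theorem getD_flatMap_of_forall_length_eq {l : List β} (h : ∀ i, (f i).length = len) (a : α)
    {i j : ℕ} (hi : i < l.length) (hj : j < len) :
    (l.flatMap f).getD (i * len + j) a = (f l[i]).getD j a := by
  induction l generalizing i with
  | nil => cases hi
  | cons b l ih =>
    rw [List.flatMap_cons]
    cases i with
    | zero => rw [List.getD_append _ _ _ _ (by rw [h]; omega), zero_mul, zero_add]; rfl
    | succ i =>
      have hsucc : (i + 1) * len + j = len + (i * len + j) := by ring
      rw [hsucc, List.getD_append_right _ _ _ _ (by rw [h]; omega), h, Nat.add_sub_cancel_left]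
      exact ih (Nat.lt_of_succ_lt_succ hi)

end EqualBlocks

namespace WordRAM

/-- `while v ≠ z do c`, to be placed at position `a` of a program. -/
def loop (v z : Fin 5) (a : ℕ) (c : Program) : Program :=
  [.jumpEq v z (a + (c.length + 2))] ++ (c ++ [.jump a])

theorem length_loop (v z : Fin 5) (a : ℕ) (c : Program) :
    (loop v z a c).length = c.length + 2 := by
  simp only [loop, List.length_append, List.length_singleton]
  omega

theorem leads_loop {w a : ℕ} {P c : Program} {v z : Fin 5} (hP : CodeAt P a (loop v z a c)) {I : ℕ}
    {ρ : ℕ → Fin 5 → ℕ} {mem : ℕ → ℕ → ℕ} (hzero : ρ 0 v = ρ 0 z)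
    (hsucc : ∀ i, ρ (i + 1) v ≠ ρ (i + 1) z)
    (hc : ∀ i < I, Effect w c (ρ (i + 1)) (mem (i + 1)) (ρ i) (mem i)) :
    Leads w P (I * (c.length + 2) + 1) a (ρ I) (mem I) (a + (c.length + 2)) (ρ 0) (mem 0) := by
  induction I with
  | zero => simpa only [zero_mul, zero_add, if_pos hzero] using leads_jumpEq (ρ := ρ 0) hP.left
  | succ I ih =>
    have hstart : Leads w P 1 a (ρ (I + 1)) (mem (I + 1)) (a + 1) (ρ (I + 1)) (mem (I + 1)) := by
      simpa only [if_neg (hsucc I)] using leads_jumpEq (ρ := ρ (I + 1)) hP.left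
    have hbody := hc I I.lt_succ_self P _ hP.right.left
    have hrest := ih fun i hi => hc i (hi.trans I.lt_succ_self)
    convert ((hstart.trans hbody).trans (leads_jump hP.right.right)).trans hrest using 1
    ring

/-- The values of the variables of a generator: zero, the number `N` of vertices, the loop
variable, the number of iterations, and an entry of the adjacency tensor. -/
def env (N i I τ : ℕ) : Fin 5 → ℕ := ![0, N, i, I, τ]

section env

variable (x N i I τ : ℕ)

@[simp] theorem env_apply_one : env N i I τ 1 = N := rfl
@[simp] theorem env_apply_two : env N i I τ 2 = i := rfl
@[simp] theorem env_apply_three : env N i I τ 3 = I := rfl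
@[simp] theorem env_apply_four : env N i I τ 4 = τ := rfl

theorem update_env_one : Function.update (env x i I τ) 1 N = env N i I τ := by
  funext v; fin_cases v <;> rfl

theorem update_env_two : Function.update (env N x I τ) 2 i = env N i I τ := by
  funext v; fin_cases v <;> rfl

theorem update_env_three : Function.update (env N i x τ) 3 I = env N i I τ := by
  funext v; fin_cases v <;> rfl

theorem update_env_four : Function.update (env N i I x) 4 τ = env N i I τ := by
  funext v; fin_cases v <;> rfl

end env

/-- `inp` consists of the number `N` and of `N ^ 3` bits. -/
structure GenInput (N : ℕ) (inp : List ℕ) : Prop where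
  getD_zero : inp.getD 0 0 = N
  length_eq : inp.length = N ^ 3 + 1
  getD_succ_le_one : ∀ x, inp.getD (1 + x) 0 ≤ 1

section Generator

variable (q : ℕ) (header body : List Expr)

/-- Read `N` and initialize the loop variable and the number of iterations of the generator. -/
def genPrologue : Program :=
  assign 0 0 ++ (fetch 1 0 ++ (assign 3 (.var 1 ^ q) ++ assign 2 (.var 3)))

/-- The loop body of the generator: decrement the loop variable, read the tensor entry that belongs
to it, and write its block. -/
def genBlock : Program :=
  assign 2 (.var 2 - 1) ++ (fetch 4 (1 + .var 2 % .var 1 ^ 3) ++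
    (emit (.var 2 * body.length) header.length body ++ assign 4 0))

/-- Write the header of the output over the input and its length to register `0`. -/
def genEpilogue : Program :=
  emit 0 0 header ++ assign 0 (header.length + .var 3 * body.length)

/-- A program that replaces its input by a header and a block of words for each `i < N ^ q`. The
blocks are written in descending order, so that the part of the input that is still needed is not
overwritten. -/
def gen : Program :=
  genPrologue q ++ (loop 2 0 (genPrologue q).length (genBlock header body) ++
    genEpilogue header body)

/-- The list of words that the program `gen` writes. -/
def genOutput (N : ℕ) (inp : List ℕ) : List ℕ :=
  header.map (Expr.eval (env N 0 (N ^ q) 0)) ++ (List.range (N ^ q)).flatMap fun i =>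
    body.map (Expr.eval (env N i (N ^ q) (inp.getD (1 + i % N ^ 3) 0)))

/-- The memory of the program `gen` when the blocks from `i` on have been written. -/
def genMem (N : ℕ) (inp : List ℕ) (i : ℕ) : ℕ → ℕ := fun x =>
  if x < i * body.length + header.length then inp.getD x 0
  else (genOutput q header body N inp).getD x 0

/-- A bound for the degrees of the expressions in the program `gen`. -/
def genDeg : ℕ :=
  q + 6 + header.length + 2 * body.length + (header.map Expr.deg).sum + (body.map Expr.deg).sum

variable {q header body}

theorem deg_le_genDeg {e : Expr} (he : e ∈ header ∨ e ∈ body) : e.deg ≤ genDeg q header body := by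
  unfold genDeg
  rcases he with he | he <;>
    exact (List.single_le_sum (fun _ _ => Nat.zero_le _) _ (List.mem_map_of_mem he)).trans
      (by omega)

variable {w N : ℕ} {inp : List ℕ}

theorem length_genOutput :
    (genOutput q header body N inp).length = header.length + N ^ q * body.length := by
  rw [genOutput, List.length_append, List.length_map,
    length_flatMap_of_forall_length_eq _ fun _ => List.length_map _, List.length_range]

theorem genOutput_getD {i j : ℕ} (hi : i < N ^ q) (hj : j < body.length) :
    (genOutput q header body N inp).getD (header.length + (i * body.length + j)) 0 =
      (body.map (Expr.eval (env N i (N ^ q) (inp.getD (1 + i % N ^ 3) 0)))).getD j 0 := by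
  rw [genOutput, List.getD_append_right _ _ _ _ (by rw [List.length_map]; omega), List.length_map,
    Nat.add_sub_cancel_left, getD_flatMap_of_forall_length_eq (fun _ => List.length_map _) 0
      (by simpa only [List.length_range] using hi) hj, List.getElem_range]

theorem writeList_genMem_succ {i : ℕ} (hi : i < N ^ q) :
    writeList (genMem q header body N inp (i + 1)) (i * body.length + header.length)
      (body.map (Expr.eval (env N i (N ^ q) (inp.getD (1 + i % N ^ 3) 0)))) =
      genMem q header body N inp i := by
  funext x
  simp only [writeList, genMem, List.length_map, Nat.succ_mul]
  by_cases hbefore : x < i * body.length + header.length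
  · rw [if_neg (by omega), if_pos (by omega), if_pos hbefore]
  · rw [if_neg hbefore]
    obtain ⟨j, rfl⟩ := Nat.exists_eq_add_of_le (not_lt.1 hbefore)
    by_cases hafter : j < body.length
    · rw [if_pos (by omega), Nat.add_sub_cancel_left, ← genOutput_getD hi hafter]
      congr 1; omega
    · rw [if_neg (by omega), if_neg (by omega)]

theorem writeList_genMem_zero :
    writeList (genMem q header body N inp 0) 0 (header.map (Expr.eval (env N 0 (N ^ q) 0))) =
      fun x => (genOutput q header body N inp).getD x 0 := by
  funext x
  simp only [writeList, genMem, List.length_map, genOutput]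
  by_cases hx : x < header.length
  · rw [if_pos (by omega), List.getD_append _ _ _ _ (by rwa [List.length_map]), Nat.sub_zero]
  · rw [if_neg (by omega), if_neg (by omega)]

theorem genMem_top (hq : 3 ≤ q) (hheader : 0 < header.length) (hbody : 0 < body.length)
    (hinp : GenInput N inp) :
    genMem q header body N inp (N ^ q) = fun x => inp.getD x 0 := by
  funext x
  have hpow : N ^ 3 ≤ N ^ q := by
    rcases Nat.eq_zero_or_pos N with rfl | hN
    · exact Nat.zero_le _
    · exact Nat.pow_le_pow_right hN hq
  have hmul : N ^ q ≤ N ^ q * body.length := Nat.le_mul_of_pos_right _ hbody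
  refine ite_eq_left_iff.2 fun hx => ?_
  rw [List.getD_eq_default _ _ (by rw [length_genOutput]; omega),
    List.getD_eq_default _ _ (by rw [hinp.length_eq]; omega)]

variable (hfit : ∀ e : Expr, e.deg ≤ genDeg q header body → ∀ i ≤ N ^ q, ∀ I ≤ N ^ q, ∀ τ ≤ 1,
  e.Fits w (env N i I τ))

include hfit

theorem effect_genPrologue (hinp : GenInput N inp) :
    Effect w (genPrologue q) (fun v => (initial inp).reg v) (fun x => inp.getD x 0)
      (env N (N ^ q) (N ^ q) 0) fun x => inp.getD x 0 := by
  have hzero : (0 : Expr).Fits w (env 0 0 0 0) := Nat.two_pow_pos w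
  have hvars : Function.update (fun v : Fin 5 => (initial inp).reg v) 0 0 = env 0 0 0 0 := by
    funext v; fin_cases v <;> rfl
  have hN : N < 2 ^ w :=
    (hfit (.var 1) (by simp [genDeg]; omega) 0 (by omega) 0 (by omega) 0 (by omega)).eval_lt
  have h₁ := effect_assign (mem := fun x => inp.getD x 0) 0
    (show (0 : Expr).Fits w fun v : Fin 5 => (initial inp).reg v from Nat.two_pow_pos w)
  have h₂ := effect_fetch (mem := fun x => inp.getD x 0) 1 hzero
    (by simpa only [Expr.eval_zero, hinp.getD_zero])
  have h₃ := effect_assign (mem := fun x => inp.getD x 0) 3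
    (hfit (.var 1 ^ q) (by simp [genDeg]; omega) 0 (by omega) 0 (by omega) 0 (by omega))
  have h₄ := effect_assign (mem := fun x => inp.getD x 0) 2
    (hfit (.var 3) (by simp [genDeg]; omega) 0 (by omega) _ le_rfl 0 (by omega))
  simp only [Expr.eval_zero, hvars] at h₁
  simp only [Expr.eval_zero, hinp.getD_zero, update_env_one] at h₂
  simp only [Expr.eval_pow, Expr.eval_var, env_apply_one, update_env_three] at h₃
  simp only [Expr.eval_var, env_apply_three, update_env_two] at h₄
  exact h₁.append (h₂.append (h₃.append h₄))

theorem effect_genBlock (hheader : 0 < header.length) (hbody : 0 < body.length)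
    (hinp : GenInput N inp) {i : ℕ} (hi : i < N ^ q) :
    Effect w (genBlock header body) (env N (i + 1) (N ^ q) 0)
      (genMem q header body N inp (i + 1)) (env N i (N ^ q) 0) (genMem q header body N inp i) := by
  have hentry : genMem q header body N inp (i + 1) (1 + i % N ^ 3) = inp.getD (1 + i % N ^ 3) 0 :=
    if_pos (by nlinarith [Nat.mod_le i (N ^ 3)])
  have hbit := hinp.getD_succ_le_one (i % N ^ 3)
  have hone : 1 < 2 ^ w := (hfit (.var 4) (by simp [genDeg]; omega) 0 (by omega) 0 (by omega) 1
    le_rfl).eval_lt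
  have h₁ := effect_assign (mem := genMem q header body N inp (i + 1)) 2
    (hfit (.var 2 - 1) (by simp [genDeg]; omega) (i + 1) hi _ le_rfl 0 (by omega))
  have h₂ := effect_fetch (mem := genMem q header body N inp (i + 1)) 4
    (hfit (1 + .var 2 % .var 1 ^ 3) (by simp [genDeg]; omega) i hi.le _ le_rfl 0 (by omega))
    (by simpa [hentry] using hbit.trans_lt hone)
  have h₃ := effect_emit (mem := genMem q header body N inp (i + 1)) (k := header.length)
    (e := .var 2 * body.length) (l := body)
    (fun j hj => hfit _ (by simp [genDeg]; omega) i hi.le _ le_rfl _ hbit)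
    (fun f hf => hfit f (deg_le_genDeg (Or.inr hf)) i hi.le _ le_rfl _ hbit)
  have h₄ := effect_assign (mem := genMem q header body N inp i) 4
    (hfit 0 (by simp [genDeg]) i hi.le _ le_rfl _ hbit)
  simp only [Expr.eval_sub, Expr.eval_var, Expr.eval_one, env_apply_two, Nat.add_sub_cancel,
    update_env_two] at h₁
  simp only [Expr.eval_add, Expr.eval_mod, Expr.eval_pow, Expr.eval_one, Expr.eval_var,
    env_apply_one, env_apply_two, hentry, update_env_four] at h₂
  simp only [Expr.eval_mul, Expr.eval_var, Expr.eval_natCast, env_apply_two,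
    writeList_genMem_succ hi] at h₃
  simp only [Expr.eval_zero, update_env_four] at h₄
  exact h₁.append (h₂.append (h₃.append h₄))

theorem effect_genEpilogue :
    Effect w (genEpilogue header body) (env N 0 (N ^ q) 0) (genMem q header body N inp 0)
      (Function.update (env N 0 (N ^ q) 0) 0 (genOutput q header body N inp).length)
      fun x => (genOutput q header body N inp).getD x 0 := by
  have h₁ := effect_emit (mem := genMem q header body N inp 0) (k := 0) (e := 0) (l := header)
    (fun j hj => hfit _ (by simp [genDeg]; omega) 0 (by omega) _ le_rfl 0 (by omega))
    (fun f hf => hfit f (deg_le_genDeg (Or.inl hf)) 0 (by omega) _ le_rfl 0 (by omega))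
  have h₂ := effect_assign (mem := fun x => (genOutput q header body N inp).getD x 0) 0
    (hfit (header.length + .var 3 * body.length) (by simp [genDeg]; omega) 0 (by omega) _ le_rfl 0
      (by omega))
  simp only [Expr.eval_zero, add_zero, writeList_genMem_zero] at h₁
  simp only [Expr.eval_add, Expr.eval_mul, Expr.eval_natCast, Expr.eval_var, env_apply_three,
    ← length_genOutput (inp := inp)] at h₂
  exact h₁.append h₂

theorem leads_gen (hq : 3 ≤ q) (hheader : 0 < header.length) (hbody : 0 < body.length)
    (hinp : GenInput N inp) :
    Leads w (gen q header body)
      ((genPrologue q).length + (N ^ q * ((genBlock header body).length + 2) + 1) +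
        (genEpilogue header body).length)
      0 (fun v => (initial inp).reg v) (fun x => inp.getD x 0) (gen q header body).length
      (Function.update (env N 0 (N ^ q) 0) 0 (genOutput q header body N inp).length)
      fun x => (genOutput q header body N inp).getD x 0 := by
  have hP : CodeAt (gen q header body) 0 (gen q header body) := ⟨[], [], by simp, rfl⟩
  have hP' : CodeAt (gen q header body) (genPrologue q).length
      (loop 2 0 (genPrologue q).length (genBlock header body) ++ genEpilogue header body) := by
    simpa only [zero_add] using hP.right
  have hstart := effect_genPrologue hfit hinp _ _ hP.left
  have hloop := leads_loop (w := w) hP'.left (I := N ^ q) (ρ := fun i => env N i (N ^ q) 0)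
    (mem := genMem q header body N inp) rfl (fun i => i.succ_ne_zero)
    fun i hi => effect_genBlock hfit hheader hbody hinp hi
  have hend := effect_genEpilogue hfit (inp := inp) _ _ hP'.right
  rw [genMem_top hq hheader hbody hinp] at hloop
  rw [zero_add] at hstart
  rw [length_loop] at hend
  convert (hstart.trans hloop).trans hend using 1
  simp only [gen, List.length_append, length_loop, add_assoc]

omit hfit

theorem fits_env_of_le {D : ℕ} (hq : 1 ≤ q) (hw : q * D * (Nat.log 2 N + 1) ≤ w) {e : Expr}
    (he : e.deg ≤ D) {i I τ : ℕ} (hi : i ≤ N ^ q) (hI : I ≤ N ^ q) (hτ : τ ≤ 1) :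
    e.Fits w (env N i I τ) := by
  set W := 2 ^ (Nat.log 2 N + 1) with hW
  have hN : N < W := Nat.lt_pow_succ_log_self one_lt_two N
  have hNq : N ^ q < W ^ q := Nat.pow_lt_pow_left hN (by omega)
  have hWq : W ≤ W ^ q := Nat.le_self_pow (by omega) W
  have hW₂ : 2 ≤ W := Nat.le_self_pow (Nat.succ_ne_zero _) 2
  refine Expr.fits_of_pow_deg_le (hW₂.trans hWq) (fun v => ?_) ?_
  · fin_cases v <;> simp only [env] <;> simp <;> omega
  · calc (W ^ q) ^ e.deg ≤ (W ^ q) ^ D := Nat.pow_le_pow_right (by positivity) he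
      _ = 2 ^ (q * D * (Nat.log 2 N + 1)) := by rw [hW, ← pow_mul, ← pow_mul]; congr 1; ring
      _ ≤ 2 ^ w := Nat.pow_le_pow_right two_pos hw

/-- If a program leaves a list in memory and its length in register `0`, then clearing the other
registers produces the initial configuration for that list. -/
theorem steps_append_clear {P : Program} {inp out : List ℕ} {t m : ℕ} {s : Config}
    (hm : ∀ i ∈ P, ∀ r, i.writes = some r → r < m) (hs : steps w P t (initial inp) = some s)
    (hpc : s.pc = P.length) (hreg : s.reg 0 = out.length) (hmem : s.mem = fun x => out.getD x 0) :
    steps w (P ++ clear m) (t + m) (initial inp) =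
      some { initial out with pc := (P ++ clear m).length } := by
  have hclear := steps_clear (w := w) (P := P ++ clear m) m (s := s)
    ⟨P, [], by rw [List.append_nil], hpc.symm⟩
  rw [steps_trans (steps_append_of_le le_rfl _ hs) hclear]
  simp only [Option.some.injEq, Config.mk.injEq]
  refine ⟨by rw [hpc, List.length_append, length_clear], funext fun r => ?_, hmem⟩
  rcases Nat.eq_zero_or_pos r with rfl | hr
  · exact hreg
  · refine (ite_eq_left_iff.2 fun hlt => ?_).trans (if_neg hr.ne').symm
    rw [steps_reg_of_writes_ne (fun i hi h => hlt ⟨hr, (hm i hi r h).le⟩) hs]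
    exact if_neg hr.ne'

theorem exists_generator (hq : 3 ≤ q) (hheader : 0 < header.length) (hbody : 0 < body.length) :
    ∃ (A : Program) (c k : ℕ), ∀ (N : ℕ) (inp : List ℕ), GenInput N inp →
      ∀ w, c * (Nat.log 2 N + 1) ≤ w → ∃ t ≤ k * (N ^ q + 1),
        steps w A t (initial inp) =
          some { initial (genOutput q header body N inp) with pc := A.length } := by
  obtain ⟨m, hm⟩ := exists_forall_writes_lt (gen q header body)
  refine ⟨gen q header body ++ clear m, q * genDeg q header body,
    (genPrologue q).length + ((genBlock header body).length + 2) + 1 +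
      (genEpilogue header body).length + m, fun N inp hinp w hw => ?_⟩
  obtain ⟨s, hs, hat⟩ := leads_gen (fun e he i hi I hI τ hτ =>
    fits_env_of_le (by omega) hw he hi hI hτ) hq hheader hbody hinp _ ⟨rfl, fun _ => rfl, rfl⟩
  refine ⟨_, ?_, steps_append_clear hm hs hat.pc_eq
    ((hat.reg_eq 0).trans (Function.update_self ..)) hat.mem_eq⟩
  generalize (genPrologue q).length = p, (genBlock header body).length + 2 = b,
    (genEpilogue header body).length = e, N ^ q = x
  nlinarith [Nat.zero_le (p * x), Nat.zero_le (e * x), Nat.zero_le (m * x)]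

end Generator

end WordRAM

/-- A unary `D`-VASS whose states are elements of a type of labels, with its transitions listed in
the order of the encoding. The state `s` of the VASS `X` becomes the number `X.code s` of the
corresponding instance of bounded reachability. -/
structure LabelledVASS (σ : Type) (D : ℕ) where
  numStates : ℕ
  states : Set σ
  code : σ → ℕ
  code_lt : ∀ s ∈ states, code s < numStates
  code_injOn : Set.InjOn code states
  trans : List (σ × (Fin D → ℤ) × σ)
  trans_ne_nil : trans ≠ []
  trans_nodup : trans.Nodup
  src_mem : ∀ t ∈ trans, t.1 ∈ states
  dst_mem : ∀ t ∈ trans, t.2.2 ∈ states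
  unary : ∀ t ∈ trans, ∀ i, t.2.1 i = -1 ∨ t.2.1 i = 0 ∨ t.2.1 i = 1

namespace LabelledVASS

variable {σ : Type} {D : ℕ} (X : LabelledVASS σ D)

theorem numStates_pos : 0 < X.numStates := by
  obtain ⟨t, ht⟩ := List.exists_mem_of_ne_nil _ X.trans_ne_nil
  exact (Nat.zero_le _).trans_lt (X.code_lt _ (X.src_mem t ht))

instance : NeZero X.numStates := ⟨X.numStates_pos.ne'⟩

/-- The size of a labelled VASS: its number of states plus its number of transitions. -/
def size : ℕ := X.numStates + X.trans.length

/-- One step of the `B`-bounded labelled VASS. -/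
def Step (B : ℕ) (c c' : σ × (Fin D → ℕ)) : Prop :=
  (∀ i, c.2 i ≤ B) ∧ (∀ i, c'.2 i ≤ B) ∧
    ∃ x : Fin D → ℤ, (c.1, x, c'.1) ∈ X.trans ∧ ∀ i, (c'.2 i : ℤ) = (c.2 i : ℤ) + x i

/-- The number of a state as an element of `Fin X.numStates`. Reduction modulo `X.numStates` only
affects labels outside `X.states`. -/
def index (s : σ) : Fin X.numStates := Fin.ofNat X.numStates (X.code s)

/-- A transition, with the labels of its endpoints replaced by their numbers. -/
def indexTrans (t : σ × (Fin D → ℤ) × σ) : Fin X.numStates × (Fin D → ℤ) × Fin X.numStates :=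
  (X.index t.1, t.2.1, X.index t.2.2)

variable {X} in
theorem val_index {s : σ} (hs : s ∈ X.states) : (X.index s).val = X.code s :=
  Nat.mod_eq_of_lt (X.code_lt s hs)

theorem index_injOn : Set.InjOn X.index X.states := fun s hs t ht h =>
  X.code_injOn hs ht <| by rw [← val_index hs, ← val_index ht, h]

theorem nodup_map_indexTrans : (X.trans.map X.indexTrans).Nodup := by
  refine List.Nodup.map_on ?_ X.trans_nodup
  rintro ⟨p, x, q⟩ h ⟨p', x', q'⟩ h' heq
  obtain ⟨hp, hx, hq⟩ : X.index p = X.index p' ∧ x = x' ∧ X.index q = X.index q' := by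
    simpa only [indexTrans, Prod.mk.injEq] using heq
  exact Prod.ext (X.index_injOn (X.src_mem _ h) (X.src_mem _ h') hp)
    (Prod.ext hx (X.index_injOn (X.dst_mem _ h) (X.dst_mem _ h') hq))

/-- The VASS on `{0, …, X.numStates - 1}` obtained by numbering the states. -/
def toVASS : VASS (Fin X.numStates) D where
  trans := ⟨X.trans.map X.indexTrans, X.nodup_map_indexTrans⟩
  trans_nonempty := by
    obtain ⟨t, ht⟩ := List.exists_mem_of_ne_nil _ X.trans_ne_nil
    exact ⟨X.indexTrans t, List.mem_map_of_mem ht⟩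

theorem mem_trans_toVASS {t : Fin X.numStates × (Fin D → ℤ) × Fin X.numStates} :
    t ∈ X.toVASS.trans ↔ ∃ u ∈ X.trans, X.indexTrans u = t :=
  List.mem_map

theorem unarySize_toVASS : X.toVASS.unarySize = X.size := by
  simp [VASS.unarySize, toVASS, size, Finset.card]

/-- The instance that asks for a run from state `s` to state `t`, with all counters zero at both
ends. -/
def inst (B : ℕ → ℕ) (s t : σ) : BoundedReachInstance D B where
  numStates := X.numStates
  vass := X.toVASS
  unary := by
    intro t ht
    obtain ⟨u, hu, rfl⟩ := X.mem_trans_toVASS.1 ht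
    exact X.unary u hu
  transList := X.trans.map X.indexTrans
  transList_nodup := X.nodup_map_indexTrans
  mem_transList _ := Iff.rfl
  source := (X.index s, fun _ => 0)
  target := (X.index t, fun _ => 0)
  source_le _ := Nat.zero_le _
  target_le _ := Nat.zero_le _

theorem size_inst (B : ℕ → ℕ) (s t : σ) :
    (boundedReachability D B).size (X.inst B s t) = X.size :=
  X.unarySize_toVASS

/-- The words that encode a transition. -/
def transWords (t : σ × (Fin D → ℤ) × σ) : List ℕ :=
  X.code t.1 :: ((List.ofFn fun i => (t.2.1 i + 1).toNat) ++ [X.code t.2.2])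

variable {X} in
theorem encode_inst (B : ℕ → ℕ) {s t : σ} (hs : s ∈ X.states) (ht : t ∈ X.states) :
    (boundedReachability D B).encode (X.inst B s t) =
      [X.numStates, X.trans.length] ++ (X.code s :: List.replicate D 0) ++
        (X.code t :: List.replicate D 0) ++ X.trans.flatMap X.transWords := by
  have hwords : (X.trans.map X.indexTrans).flatMap (fun t =>
      t.1.val :: ((List.ofFn fun i => (t.2.1 i + 1).toNat) ++ [t.2.2.val])) =
      X.trans.flatMap X.transWords := by
    rw [List.flatMap_map]
    refine List.flatMap_congr fun u hu => ?_
    simp only [indexTrans, transWords, val_index (X.src_mem u hu), val_index (X.dst_mem u hu)]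
  simp only [boundedReachability, BoundedReachInstance.encode, inst, List.length_map,
    List.ofFn_const, val_index hs, val_index ht, hwords]

variable {X} in
theorem bReach_toVASS_iff (B : ℕ) {s t : σ} (hs : s ∈ X.states) (ht : t ∈ X.states)
    (u v : Fin D → ℕ) :
    X.toVASS.BReach B (X.index s, u) (X.index t, v) ↔
      Relation.ReflTransGen (X.Step B) (s, u) (t, v) := by
  constructor
  · intro h
    have lift_run : ∀ c, X.toVASS.BReach B (X.index s, u) c →
        ∃ q ∈ X.states, X.index q = c.1 ∧ Relation.ReflTransGen (X.Step B) (s, u) (q, c.2) := by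
      intro c hc
      induction hc with
      | refl => exact ⟨s, hs, rfl, .refl⟩
      | @tail c c' _ hstep ih =>
        obtain ⟨q, hq, hqc, hrun⟩ := ih
        obtain ⟨hle, hle', x, hx, heq⟩ := hstep
        obtain ⟨⟨p, y, p'⟩, hmem, hp⟩ := X.mem_trans_toVASS.1 hx
        obtain ⟨hpc, rfl, hpc'⟩ : X.index p = c.1 ∧ y = x ∧ X.index p' = c'.1 := by
          simpa only [indexTrans, Prod.mk.injEq] using hp
        obtain rfl := X.index_injOn (X.src_mem _ hmem) hq (hpc.trans hqc.symm)
        exact ⟨p', X.dst_mem _ hmem, hpc', hrun.tail ⟨hle, hle', y, hmem, heq⟩⟩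
    obtain ⟨q, hq, hqt, hrun⟩ := lift_run _ h
    rwa [← X.index_injOn hq ht hqt]
  · exact Relation.ReflTransGen.lift (fun c : σ × (Fin D → ℕ) => (X.index c.1, c.2))
      (fun c c' ⟨hle, hle', x, hx, heq⟩ =>
        ⟨hle, hle', x, X.mem_trans_toVASS.2 ⟨_, hx, rfl⟩, heq⟩) _ _

variable {X} in
theorem yes_inst_iff (B : ℕ → ℕ) {s t : σ} (hs : s ∈ X.states) (ht : t ∈ X.states) :
    (boundedReachability D B).Yes (X.inst B s t) ↔
      Relation.ReflTransGen (X.Step (B X.size)) (s, fun _ => 0) (t, fun _ => 0) := by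
  rw [← bReach_toVASS_iff _ hs ht, ← X.unarySize_toVASS]
  rfl

end LabelledVASS

/-! ### Sublinear time does not suffice to read the input -/

namespace WordRAM

variable {w : ℕ} {P : Program} {s s' : Config}

theorem Instr.exists_exec_congr (i : Instr) (h : i.exec w s = some s') :
    ∃ a, ∀ mem : ℕ → ℕ, mem a = s.mem a →
      ∃ mem', i.exec w { s with mem := mem } = some { s' with mem := mem' } ∧
        ∀ x, mem x = s.mem x → mem' x = s'.mem x := by
  cases i with
  | halt => cases h
  | jump | jumpLt | jumpEq =>
    cases h
    exact ⟨0, fun mem _ => ⟨mem, rfl, fun x hx => hx⟩⟩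
  | const | op =>
    obtain ⟨hlt, rfl⟩ := setReg_eq_some_iff.1 h
    exact ⟨0, fun mem _ => ⟨mem, setReg_eq_some_iff.2 ⟨hlt, rfl⟩, fun x hx => hx⟩⟩
  | load r a =>
    obtain ⟨hlt, rfl⟩ := setReg_eq_some_iff.1 h
    exact ⟨s.reg a, fun mem hmem => ⟨mem,
      setReg_eq_some_iff.2 ⟨hmem.trans_lt hlt, by dsimp only; rw [hmem]⟩, fun x hx => hx⟩⟩
  | store a r =>
    cases h
    refine ⟨0, fun mem _ => ⟨Function.update mem (s.reg a) (s.reg r), rfl, fun x hx => ?_⟩⟩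
    rcases eq_or_ne x (s.reg a) with rfl | hne
    · simp only [Function.update_self]
    · simpa only [Function.update_of_ne hne] using hx

theorem exists_finset_steps_congr {t : ℕ} (h : steps w P t s = some s') :
    ∃ F : Finset ℕ, F.card ≤ t ∧ ∀ mem : ℕ → ℕ, (∀ x ∈ F, mem x = s.mem x) →
      ∃ mem', steps w P t { s with mem := mem } = some { s' with mem := mem' } := by
  induction t generalizing s with
  | zero =>
    cases h
    exact ⟨∅, le_rfl, fun mem _ => ⟨mem, rfl⟩⟩
  | succ t ih =>
    obtain ⟨s₁, h₁, h₂⟩ := Option.bind_eq_some_iff.1 h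
    obtain ⟨i, hi, hex⟩ := step_eq_some_iff.1 h₁
    obtain ⟨a, ha⟩ := i.exists_exec_congr hex
    obtain ⟨F, hcard, hF⟩ := ih h₂
    refine ⟨insert a F, (Finset.card_insert_le _ _).trans (by omega), fun mem hmem => ?_⟩
    obtain ⟨mem₁, hex₁, hmem₁⟩ := ha mem (hmem a (Finset.mem_insert_self _ _))
    obtain ⟨mem', hsteps⟩ := hF mem₁ fun x hx => hmem₁ x (hmem x (Finset.mem_insert_of_mem hx))
    exact ⟨mem', Option.bind_eq_some_iff.2 ⟨_, step_eq_some_iff.2 ⟨i, hi, hex₁⟩, hsteps⟩⟩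

theorem Outputs.exists_finset_congr {inp : List ℕ} {t out : ℕ} (h : Outputs w P inp t out) :
    ∃ F : Finset ℕ, F.card ≤ t ∧ ∀ {inp' : List ℕ} {t' out' : ℕ}, inp'.length = inp.length →
      (∀ x ∈ F, inp'.getD x 0 = inp.getD x 0) → Outputs w P inp' t' out' → out' = out := by
  obtain ⟨-, -, s, hs, hhalt, rfl⟩ := h
  obtain ⟨F, hcard, hF⟩ := exists_finset_steps_congr hs
  refine ⟨F, hcard, fun {inp' t' out'} hlen hagree ⟨_, _, s', hs', hhalt', hout'⟩ => ?_⟩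
  obtain ⟨mem', hmem'⟩ := hF _ hagree
  have hinitial : { initial inp with mem := fun x => inp'.getD x 0 } = initial inp' := by
    simp only [initial, hlen]
  rw [hinitial] at hmem'
  rw [← hout', ← steps_halt_unique hmem' hs' hhalt hhalt']

end WordRAM

/-- The time to decide a problem is at least the sensitivity of the problem at any instance. -/
theorem DecisionProblem.DecidableInTime.sensitivity_le {A : DecisionProblem} {T : ℕ → ℕ}
    (h : A.DecidableInTime T) (x : A.Instance) {M : ℕ} (y : Fin M → A.Instance) {pos : Fin M → ℕ}
    (hpos : Function.Injective pos) (hsize : ∀ a, A.size (y a) = A.size x)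
    (hlen : ∀ a, (A.encode (y a)).length = (A.encode x).length)
    (hagree : ∀ a p, p ≠ pos a → (A.encode (y a)).getD p 0 = (A.encode x).getD p 0)
    (hyes : ∀ a, ¬ (A.Yes (y a) ↔ A.Yes x)) : M ≤ T (A.size x) := by
  obtain ⟨P, c, hP⟩ := h
  obtain ⟨t, ht, out, hout, hans⟩ := hP x
  obtain ⟨F, hcard, hF⟩ := hout.exists_finset_congr
  by_contra! hlt
  obtain ⟨p, hp, hpF⟩ := Finset.exists_mem_notMem_of_card_lt_card
    (s := F) (t := Finset.univ.image pos) (by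
      rw [Finset.card_image_of_injective _ hpos, Finset.card_fin]; omega)
  obtain ⟨a, -, rfl⟩ := Finset.mem_image.1 hp
  obtain ⟨t', -, out', hout', hans'⟩ := hP (y a)
  rw [hsize a] at hout'
  obtain rfl := hF (hlen a) (fun q hq => hagree a q fun h => hpF (h ▸ hq)) hout'
  have := hyes a
  grind

theorem getD_append_congr {α : Type*} {l l₁ l₂ : List α} {a : α} {p : ℕ}
    (h : ∀ q, p = l.length + q → l₁.getD q a = l₂.getD q a) :
    (l ++ l₁).getD p a = (l ++ l₂).getD p a := by
  rcases lt_or_ge p l.length with hp | hp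
  · rw [List.getD_append _ _ _ _ hp, List.getD_append _ _ _ _ hp]
  · rw [List.getD_append_right _ _ _ _ hp, List.getD_append_right _ _ _ _ hp, h _ (by omega)]

theorem getD_flatMap_congr {α β : Type*} {f g : β → List α} {len : ℕ} {l : List β} {a : α} {p : ℕ}
    (hf : ∀ b, (f b).length = len) (hg : ∀ b, (g b).length = len)
    (h : ∀ i (hi : i < l.length), ∀ j < len, p = i * len + j →
      (f l[i]).getD j a = (g l[i]).getD j a) :
    (l.flatMap f).getD p a = (l.flatMap g).getD p a := by
  rcases le_or_gt (l.length * len) p with hp | hp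
  · rw [List.getD_eq_default _ _ (by rwa [length_flatMap_of_forall_length_eq _ hf]),
      List.getD_eq_default _ _ (by rwa [length_flatMap_of_forall_length_eq _ hg])]
  have hi : p / len < l.length := Nat.div_lt_of_lt_mul (by rwa [mul_comm])
  have hj : p % len < len := Nat.mod_lt _ (Nat.pos_of_ne_zero fun h => by simp [h] at hp)
  rw [← Nat.div_add_mod' p len, getD_flatMap_of_forall_length_eq hf a hi hj,
    getD_flatMap_of_forall_length_eq hg a hi hj, h _ hi _ hj (Nat.div_add_mod' p len).symm]

/-- A star with `M` transitions from state `0`; transition `a` leads to state `1`, the others lead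
to different further states. Whether state `1` is reachable depends on each word that encodes the
end of a transition. -/
def starVASS (D : ℕ) {M : ℕ} (hM : 0 < M) (a : ℕ) : LabelledVASS ℕ D where
  numStates := M + 2
  states := Set.Iio (M + 2)
  code := id
  code_lt _ hs := hs
  code_injOn := Set.injOn_id _
  trans := (List.range M).map fun i => (0, fun _ => 0, if i = a then 1 else i + 2)
  trans_ne_nil := by simpa using hM.ne'
  trans_nodup := by
    refine List.Nodup.map (fun i j h => ?_) List.nodup_range
    simp only [Prod.mk.injEq, true_and] at h
    grind
  src_mem := by simp
  dst_mem := by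
    simp only [List.forall_mem_map, List.mem_range, Set.mem_Iio]
    grind
  unary := by simp

namespace starVASS

variable {D M : ℕ} (hM : 0 < M) (a : ℕ)

theorem size_eq : (starVASS D hM a).size = 2 * M + 2 := by
  simp only [LabelledVASS.size, starVASS, List.length_map, List.length_range]
  omega

theorem yes_iff (B : ℕ → ℕ) :
    (boundedReachability D B).Yes ((starVASS D hM a).inst B 0 1) ↔ a < M := by
  have zero_mem : 0 ∈ (starVASS D hM a).states := Nat.succ_pos _
  have one_mem : 1 ∈ (starVASS D hM a).states := Nat.succ_lt_succ (Nat.succ_pos _)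
  rw [LabelledVASS.yes_inst_iff B zero_mem one_mem]
  constructor
  · intro hrun
    obtain h | ⟨c, -, -, -, x, hx, -⟩ := Relation.ReflTransGen.cases_tail hrun
    · cases h
    · obtain ⟨i, hi, heq⟩ := List.mem_map.1 hx
      simp only [Prod.mk.injEq] at heq
      grind
  · intro ha
    exact .single ⟨fun _ => zero_le, fun _ => zero_le, fun _ => 0,
      List.mem_map.2 ⟨a, List.mem_range.2 ha, by rw [if_pos rfl]⟩, fun _ => rfl⟩

theorem encode_eq (B : ℕ → ℕ) :
    (boundedReachability D B).encode ((starVASS D hM a).inst B 0 1) =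
      [M + 2, M] ++ (0 :: List.replicate D 0) ++ (1 :: List.replicate D 0) ++
        (List.range M).flatMap fun i =>
          (0 :: List.replicate D 1) ++ [if i = a then 1 else i + 2] := by
  rw [LabelledVASS.encode_inst B (Nat.succ_pos _) (Nat.succ_lt_succ (Nat.succ_pos _))]
  simp [starVASS, LabelledVASS.transWords, List.flatMap_map]

theorem length_encode (B : ℕ → ℕ) :
    ((boundedReachability D B).encode ((starVASS D hM a).inst B 0 1)).length =
      2 * D + 4 + M * (D + 2) := by
  rw [encode_eq, List.length_append,
    length_flatMap_of_forall_length_eq (len := D + 2) _ fun i => by simp]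
  simp
  ring

theorem getD_encode (B : ℕ → ℕ) {a : ℕ} {p : ℕ} (hp : p ≠ 2 * D + 4 + (a * (D + 2) + (D + 1))) :
    ((boundedReachability D B).encode ((starVASS D hM a).inst B 0 1)).getD p 0 =
      ((boundedReachability D B).encode ((starVASS D hM M).inst B 0 1)).getD p 0 := by
  simp only [encode_eq]
  refine getD_append_congr fun q hq => getD_flatMap_congr (len := D + 2) (by simp) (by simp) ?_
  rintro i hi j hj rfl
  have hiM : i ≠ M := (List.length_range (n := M) ▸ hi).ne
  simp only [List.getElem_range, if_neg hiM]
  rcases eq_or_ne i a with rfl | hia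
  · refine getD_append_congr fun k hk => absurd hq ?_
    simp only [List.length_append, List.length_cons, List.length_nil, List.length_replicate]
      at hk ⊢
    omega
  · rw [if_neg hia]

end starVASS

theorem not_decidableInTime_boundedReachability_of_isLittleO (D : ℕ) (B : ℕ → ℕ) {T : ℕ → ℕ}
    (hT : (fun n : ℕ => (T n : ℝ)) =o[atTop] fun n : ℕ => (n : ℝ)) :
    ¬ (boundedReachability D B).DecidableInTime T := by
  intro h
  have le_T : ∀ M, 0 < M → M ≤ T (2 * M + 2) := by
    intro M hM
    let star := fun a : ℕ => (starVASS D hM a).inst B 0 1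
    have hsize : ∀ a, (boundedReachability D B).size (star a) = 2 * M + 2 := fun a => by
      rw [LabelledVASS.size_inst, starVASS.size_eq]
    have key := h.sensitivity_le (star M) (fun a : Fin M => star a)
      (pos := fun a => 2 * D + 4 + (a * (D + 2) + (D + 1)))
      (fun a b hab => Fin.ext (Nat.eq_of_mul_eq_mul_right (by omega : 0 < D + 2) (by
        simpa using hab)))
      (fun a => by rw [hsize, hsize])
      (fun a => by rw [starVASS.length_encode, starVASS.length_encode])
      (fun a p hp => starVASS.getD_encode hM B hp)
      (fun a => by simp [star, starVASS.yes_iff])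
    rwa [hsize] at key
  obtain ⟨n₀, hn₀⟩ := eventually_atTop.1 (hT.def (c := 1 / 5) (by norm_num))
  have hupper := hn₀ (2 * (n₀ + 1) + 2) (by omega)
  have hlower : ((n₀ + 1 : ℕ) : ℝ) ≤ T (2 * (n₀ + 1) + 2) := mod_cast le_T _ n₀.succ_pos
  rw [Real.norm_natCast, Real.norm_natCast] at hupper
  push_cast at hupper hlower
  linarith [Nat.cast_nonneg (α := ℝ) n₀]

/-! ### The VASS of a hypergraph -/

theorem mul_add_lt_mul_of_lt {a b i I : ℕ} (hab : a < b) (hi : i < I) : a * I + i < b * I :=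
  calc a * I + i < (a + 1) * I := by rw [add_one_mul]; exact Nat.add_lt_add_left hi _
    _ ≤ b * I := Nat.mul_le_mul_right I hab

theorem mul_add_inj {a b i j I : ℕ} (hi : i < I) (hj : j < I) (h : a * I + i = b * I + j) :
    a = b ∧ i = j := by
  have hab : a = b := by
    by_contra hne
    rcases lt_or_gt_of_ne hne with hlt | hlt
    · exact absurd h ((mul_add_lt_mul_of_lt hlt hi).trans_le (Nat.le_add_right _ _)).ne
    · exact absurd h ((mul_add_lt_mul_of_lt hlt hj).trans_le (Nat.le_add_right _ _)).ne'
  subst hab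
  exact ⟨rfl, Nat.add_left_cancel h⟩

theorem nodup_flatMap_of_key {α β : Type*} {l : List α} {f : α → List β} (key : β → α)
    (hl : l.Nodup) (hkey : ∀ a ∈ l, ∀ b ∈ f a, key b = a) (hf : ∀ a ∈ l, (f a).Nodup) :
    (l.flatMap f).Nodup :=
  List.nodup_flatMap.2 ⟨hf, hl.pairwise_of_forall_ne fun a ha b hb hab x hxa hxb =>
    hab ((hkey a ha x hxa).symm.trans (hkey b hb x hxb))⟩

namespace WordRAM.Expr

/-- The expression with value `1` if `a ≤ b` and `0` otherwise. -/
def le (a b : Expr) : Expr := 1 - (a - b)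

/-- The expression with value `1` if `a = b` and `0` otherwise. -/
def eq (a b : Expr) : Expr := le a b * le b a

/-- The expression with the value of `a` if that of `c` is `1`, and of `b` otherwise. -/
def ite (c a b : Expr) : Expr := eq c 1 * a + (1 - eq c 1) * b

variable (ρ : Fin 5 → ℕ) (a b c : Expr)

theorem eval_le_eq_one_iff : (le a b).eval ρ = 1 ↔ a.eval ρ ≤ b.eval ρ := by
  simp only [le, eval_sub, eval_one]
  omega

theorem eval_eq_eq_one_iff : (eq a b).eval ρ = 1 ↔ a.eval ρ = b.eval ρ := by
  rw [eq, eval_mul, mul_eq_one, eval_le_eq_one_iff, eval_le_eq_one_iff, le_antisymm_iff]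

theorem eval_eq_le_one : (eq a b).eval ρ ≤ 1 :=
  Nat.mul_le_mul (Nat.sub_le _ _) (Nat.sub_le _ _)

theorem eval_ite : (ite c a b).eval ρ = if c.eval ρ = 1 then a.eval ρ else b.eval ρ := by
  have hle := eval_eq_le_one ρ c 1
  have hone := eval_eq_eq_one_iff ρ c 1
  rw [eval_one] at hone
  simp only [ite, eval_add, eval_mul, eval_sub, eval_one]
  split_ifs with h
  · rw [hone.2 h, one_mul, Nat.sub_self, zero_mul, add_zero]
  · rw [Nat.lt_one_iff.1 (lt_of_le_of_ne hle (mt hone.1 h)), zero_mul, zero_add, Nat.sub_zero,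
      one_mul]

end WordRAM.Expr

open WordRAM

/-- The parameters of the reduction: `d` counters encode `K` vertices each, and `R` triples of
vertices have to be checked. The vertex `σ` of the triple `r` is the digit at position
`(tri r σ).2` of the counter `(tri r σ).1`. There are `D` counters altogether, and `pad` controls
the number of isolated states. -/
structure Shape where
  d : ℕ
  D : ℕ
  K : ℕ
  R : ℕ
  tri : ℕ → Fin 3 → ℕ × ℕ
  pad : ℕ
  d_lt_D : d < D
  tri_lt : ∀ r < R, ∀ σ, (tri r σ).1 < d ∧ (tri r σ).2 < K

/-- The states of the VASS of a hypergraph. In state `check r` the triples before `r` have been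
checked. To check the triple `r`, the number `m` of an entry of the adjacency tensor is guessed;
then, for each counter `j`, the states `down r j i` subtract `g` from it and `up r j i` add `g`
again, where `i = m + g * N ^ 3` tells the guess and the part of the counter that is missing. The
states `drain s` take back what a unit of a counter contributed to the sum. The states `dead i`
are the ends of the transitions that are disabled.

The indices are numbers, or expressions when a program writes the transitions. -/
inductive State (ι : Type) where
  | check (r : ℕ)
  | down (r j : ℕ) (i : ι)
  | up (r j : ℕ) (i : ι)
  | drain (s : ℕ)
  | dead (i : ι)

/-- Apply a function to the index of a state. -/
def State.map {ι κ : Type} (f : ι → κ) : State ι → State κ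
  | check r => check r
  | down r j i => down r j (f i)
  | up r j i => up r j (f i)
  | drain s => drain s
  | dead i => dead (f i)

/-- A family of transitions indexed by the variables of an environment; a transition leads to
`dst` if `guard` has the value `1`, and to a dead state otherwise. -/
structure Rule (D : ℕ) where
  src : State Expr
  vec : Fin D → ℤ
  guard : Expr := 1
  dst : State Expr

/-- The transition of a family in an environment. -/
def Rule.eval {D : ℕ} (ρ : Fin 5 → ℕ) (t : Rule D) : State ℕ × (Fin D → ℤ) × State ℕ :=
  (t.src.map (Expr.eval ρ), t.vec,
    if t.guard.eval ρ = 1 then t.dst.map (Expr.eval ρ) else .dead (ρ 2))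

theorem Rule.eval_of_guard {D : ℕ} {ρ : Fin 5 → ℕ} {t : Rule D} (h : t.guard.eval ρ = 1) :
    t.eval ρ = (t.src.map (Expr.eval ρ), t.vec, t.dst.map (Expr.eval ρ)) := by
  rw [Rule.eval, if_pos h]

namespace Shape

variable (S : Shape)

/-- The number of indices of a family of states, for a hypergraph with `N` vertices. -/
def numIndices (N : ℕ) : ℕ := N ^ (S.K + 3)

/-- The vector with the entries `x` for the first `d` counters and `y` for the next one. -/
def vec (x : ℕ → ℤ) (y : ℤ) : Fin S.D → ℤ := fun i =>
  if i.val < S.d then x i.val else if i.val = S.d then y else 0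

open State

section Rules

/-- The vertex `σ` of the triple `r`, if it is a digit of counter `j`, is the digit `σ` of the
guessed number. -/
def digitGuard (r j : ℕ) (σ : Fin 3) : Expr :=
  if (S.tri r σ).1 = j then
    .eq (.var 2 / .var 1 ^ (3 + (S.tri r σ).2) % .var 1) (.var 2 / .var 1 ^ σ.val % .var 1)
  else 1

variable (r j s : ℕ)

/-- Build the vertices: increment counter `j` before the first check. -/
def load : Rule S.D where
  src := check 0
  vec := S.vec (Pi.single j 1) 0
  dst := check 0

/-- Guess the number of an entry of the adjacency tensor that is `1`. -/
def guess : Rule S.D where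
  src := check r
  vec := S.vec 0 0
  guard := .le (.var 2 + 1) (.var 1 ^ 3) * .eq (.var 4) 1
  dst := down r 0 (.var 2)

/-- Subtract `1` from counter `j` and remember it in the index. -/
def decrease : Rule S.D where
  src := down r j (.var 2)
  vec := S.vec (-Pi.single j 1) 1
  guard := .le (.var 2 + .var 1 ^ 3 + 1) (.var 3)
  dst := down r j (.var 2 + .var 1 ^ 3)

/-- Compare the digits of the whole counter `j`, which the index knows if the counter is now
`0`, with the guess. -/
def turn : Rule S.D where
  src := down r j (.var 2)
  vec := S.vec 0 0
  guard := S.digitGuard r j 0 * (S.digitGuard r j 1 * S.digitGuard r j 2)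
  dst := up r j (.var 2)

/-- Add `1` back to counter `j`. -/
def increase : Rule S.D where
  src := up r j (.var 2)
  vec := S.vec (Pi.single j 1) 0
  guard := .le (.var 1 ^ 3) (.var 2)
  dst := up r j (.var 2 - .var 1 ^ 3)

/-- Go on to the next counter once counter `j` is restored. -/
def next : Rule S.D where
  src := up r j (.var 2)
  vec := S.vec 0 0
  guard := .le (.var 2 + 1) (.var 1 ^ 3)
  dst := down r (j + 1) (.var 2)

/-- Finish the check of the triple `r` after all counters. -/
def pass : Rule S.D where
  src := down r S.d (.var 2)
  vec := S.vec 0 0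
  guard := .le (.var 2 + 1) (.var 1 ^ 3)
  dst := check (r + 1)

/-- After all checks, subtract `1` from a counter in order to drain it. -/
def enter : Rule S.D where
  src := check S.R
  vec := S.vec (-Pi.single j 1) 0
  dst := drain S.R

/-- Subtract from the sum one of the `R` units that a unit of a counter contributed to it. -/
def discharge : Rule S.D where
  src := drain (s + 1)
  vec := S.vec 0 (-1)
  dst := drain s

/-- Return for the next unit of a counter. -/
def leave : Rule S.D where
  src := drain 0
  vec := S.vec 0 0
  dst := check S.R

/-- The transitions that occur once. -/
def headerRules : List (Rule S.D) :=
  (List.range S.d).map S.load ++ ((List.range S.d).map S.enter ++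
    ((List.range S.R).map S.discharge ++ [S.leave]))

/-- The transitions from `down r j i` and `up r j i`, for any index `i`. -/
def counterRules : List (Rule S.D) :=
  [S.decrease r j, S.turn r j, S.increase r j, S.next r j]

/-- The transitions that occur once for each index. -/
def bodyRules : List (Rule S.D) :=
  (List.range S.R).flatMap fun r =>
    [S.guess r, S.pass r] ++ (List.range S.d).flatMap (S.counterRules r)

end Rules

/-- The transitions of the VASS of a hypergraph with `N` vertices and adjacency tensor `T`. -/
def trans (N : ℕ) (T : ℕ → ℕ) : List (State ℕ × (Fin S.D → ℤ) × State ℕ) :=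
  S.headerRules.map (Rule.eval (env N 0 (S.numIndices N) 0)) ++
    (List.range (S.numIndices N)).flatMap fun i =>
      S.bodyRules.map (Rule.eval (env N i (S.numIndices N) (T (i % N ^ 3))))

/-- There is an enabled transition from one state to another that adds `x` to the first `d`
counters and `y` to the next one. -/
inductive Edge (N : ℕ) (T : ℕ → ℕ) : State ℕ → (ℕ → ℤ) → ℤ → State ℕ → Prop
  | load {j} (hj : j < S.d) : Edge N T (check 0) (Pi.single j 1) 0 (check 0)
  | guess {r m} (hr : r < S.R) (hI : m < S.numIndices N) (hm : m < N ^ 3) (hT : T m = 1) :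
      Edge N T (check r) 0 0 (down r 0 m)
  | decrease {r j i} (hr : r < S.R) (hj : j < S.d) (hi : i + N ^ 3 < S.numIndices N) :
      Edge N T (down r j i) (-Pi.single j 1) 1 (down r j (i + N ^ 3))
  | turn {r j i} (hr : r < S.R) (hj : j < S.d) (hi : i < S.numIndices N)
      (hdigit : ∀ σ : Fin 3, (S.tri r σ).1 = j →
        i / N ^ (3 + (S.tri r σ).2) % N = i / N ^ σ.val % N) :
      Edge N T (down r j i) 0 0 (up r j i)
  | increase {r j i} (hr : r < S.R) (hj : j < S.d) (hi : i + N ^ 3 < S.numIndices N) :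
      Edge N T (up r j (i + N ^ 3)) (Pi.single j 1) 0 (up r j i)
  | next {r j i} (hr : r < S.R) (hj : j < S.d) (hI : i < S.numIndices N) (hi : i < N ^ 3) :
      Edge N T (up r j i) 0 0 (down r (j + 1) i)
  | pass {r i} (hr : r < S.R) (hI : i < S.numIndices N) (hi : i < N ^ 3) :
      Edge N T (down r S.d i) 0 0 (check (r + 1))
  | enter {j} (hj : j < S.d) : Edge N T (check S.R) (-Pi.single j 1) 0 (drain S.R)
  | discharge {s} (hs : s < S.R) : Edge N T (drain (s + 1)) 0 (-1) (drain s)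
  | leave : Edge N T (drain 0) 0 0 (check S.R)

theorem forall_mem_headerRules {p : Rule S.D → Prop} : (∀ t ∈ S.headerRules, p t) ↔
    (∀ j < S.d, p (S.load j)) ∧ (∀ j < S.d, p (S.enter j)) ∧ (∀ s < S.R, p (S.discharge s)) ∧
      p S.leave := by
  simp only [headerRules, List.forall_mem_append, List.forall_mem_map, List.mem_range,
    List.forall_mem_singleton]

theorem forall_mem_bodyRules {p : Rule S.D → Prop} : (∀ t ∈ S.bodyRules, p t) ↔
    ∀ r < S.R, (p (S.guess r) ∧ p (S.pass r)) ∧ ∀ j < S.d, p (S.decrease r j) ∧ p (S.turn r j) ∧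
      p (S.increase r j) ∧ p (S.next r j) := by
  simp only [bodyRules, counterRules, List.forall_mem_flatMap, List.forall_mem_append,
    List.forall_mem_cons, List.not_mem_nil, false_imp_iff, implies_true, and_true, List.mem_range]

variable {S} {N : ℕ} {T : ℕ → ℕ}

theorem forall_mem_trans {p : State ℕ × (Fin S.D → ℤ) × State ℕ → Prop} :
    (∀ t ∈ S.trans N T, p t) ↔
      (∀ t ∈ S.headerRules, p (t.eval (env N 0 (S.numIndices N) 0))) ∧
      ∀ i < S.numIndices N, ∀ t ∈ S.bodyRules,
        p (t.eval (env N i (S.numIndices N) (T (i % N ^ 3)))) := by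
  simp only [trans, List.forall_mem_append, List.forall_mem_map, List.forall_mem_flatMap,
    List.mem_range]

theorem eval_digitGuard {i I τ r j : ℕ} {σ : Fin 3} :
    (S.digitGuard r j σ).eval (env N i I τ) = 1 ↔
      ((S.tri r σ).1 = j → i / N ^ (3 + (S.tri r σ).2) % N = i / N ^ σ.val % N) := by
  by_cases h : (S.tri r σ).1 = j
  · simp [digitGuard, h, Expr.eval_eq_eq_one_iff]
  · simp [digitGuard, h]

theorem mem_trans_of_mem_headerRules {t : Rule S.D} (ht : t ∈ S.headerRules) :
    t.eval (env N 0 (S.numIndices N) 0) ∈ S.trans N T :=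
  (forall_mem_trans.1 fun _ => id).1 t ht

theorem mem_trans_of_mem_bodyRules {t : Rule S.D} (ht : t ∈ S.bodyRules) {i : ℕ}
    (hi : i < S.numIndices N)
    (hguard : t.guard.eval (env N i (S.numIndices N) (T (i % N ^ 3))) = 1) :
    (t.src.map (Expr.eval (env N i (S.numIndices N) (T (i % N ^ 3)))), t.vec,
      t.dst.map (Expr.eval (env N i (S.numIndices N) (T (i % N ^ 3))))) ∈ S.trans N T := by
  rw [← Rule.eval_of_guard hguard]
  exact (forall_mem_trans.1 fun _ => id).2 i hi t ht

theorem mem_trans_of_edge {s s' : State ℕ} {x : ℕ → ℤ} {y : ℤ} (h : S.Edge N T s x y s') :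
    (s, S.vec x y, s') ∈ S.trans N T := by
  obtain ⟨hload, henter, hdischarge, hleave⟩ := S.forall_mem_headerRules.1 fun _ => id
  have hbody := S.forall_mem_bodyRules.1 fun _ => id
  cases h with
  | load hj => exact mem_trans_of_mem_headerRules (hload _ hj)
  | enter hj => exact mem_trans_of_mem_headerRules (henter _ hj)
  | discharge hs => exact mem_trans_of_mem_headerRules (hdischarge _ hs)
  | leave => exact mem_trans_of_mem_headerRules hleave
  | guess hr hI hm hT =>
    refine mem_trans_of_mem_bodyRules (hbody _ hr).1.1 hI ?_
    simp [guess, Expr.eval_le_eq_one_iff, Expr.eval_eq_eq_one_iff, Nat.mod_eq_of_lt, hm, hT]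
  | decrease hr hj hi =>
    refine mem_trans_of_mem_bodyRules ((hbody _ hr).2 _ hj).1 (Nat.lt_of_add_right_lt hi) ?_
    exact (Expr.eval_le_eq_one_iff ..).2 hi
  | turn hr hj hi hdigit =>
    refine mem_trans_of_mem_bodyRules ((hbody _ hr).2 _ hj).2.1 hi ?_
    simp only [turn, Expr.eval_mul, mul_eq_one, eval_digitGuard]
    exact ⟨hdigit 0, hdigit 1, hdigit 2⟩
  | increase hr hj hi =>
    have hmem := mem_trans_of_mem_bodyRules (T := T) ((hbody _ hr).2 _ hj).2.2.1 hi
      (by simp [increase, Expr.eval_le_eq_one_iff])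
    simpa [increase, State.map] using hmem
  | next hr hj hI hi =>
    exact mem_trans_of_mem_bodyRules ((hbody _ hr).2 _ hj).2.2.2 hI
      ((Expr.eval_le_eq_one_iff ..).2 hi)
  | pass hr hI hi =>
    exact mem_trans_of_mem_bodyRules (hbody _ hr).1.2 hI ((Expr.eval_le_eq_one_iff ..).2 hi)

theorem edge_or_dead {ρ : Fin 5 → ℕ} (t : Rule S.D) {x : ℕ → ℤ} {y : ℤ} (hvec : t.vec = S.vec x y)
    (h : t.guard.eval ρ = 1 →
      S.Edge N T (t.src.map (Expr.eval ρ)) x y (t.dst.map (Expr.eval ρ))) :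
    (∃ x y, (t.eval ρ).2.1 = S.vec x y ∧ S.Edge N T (t.eval ρ).1 x y (t.eval ρ).2.2) ∨
      (t.eval ρ).2.2 = dead (ρ 2) := by
  by_cases hguard : t.guard.eval ρ = 1
  · rw [Rule.eval_of_guard hguard]
    exact .inl ⟨x, y, hvec, h hguard⟩
  · exact .inr (if_neg hguard)

theorem edge_or_dead_of_mem_trans : ∀ t ∈ S.trans N T,
    (∃ x y, t.2.1 = S.vec x y ∧ S.Edge N T t.1 x y t.2.2) ∨
      ∃ i < S.numIndices N, t.2.2 = dead i := by
  refine forall_mem_trans.2 ⟨fun t ht => .inl ?_, fun i hi t ht => ?_⟩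
  · revert t
    exact S.forall_mem_headerRules.2 ⟨fun j hj => ⟨_, _, rfl, .load hj⟩,
      fun j hj => ⟨_, _, rfl, .enter hj⟩, fun s hs => ⟨_, _, rfl, .discharge hs⟩,
      ⟨_, _, rfl, .leave⟩⟩
  · refine Or.imp_right (fun h => ⟨i, hi, h⟩) ?_
    revert t
    refine S.forall_mem_bodyRules.2 fun r hr => ⟨⟨?_, ?_⟩, fun j hj => ⟨?_, ?_, ?_, ?_⟩⟩
    · refine edge_or_dead (S.guess r) rfl fun h => ?_
      simp only [guess, Expr.eval_mul, mul_eq_one, Expr.eval_le_eq_one_iff,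
        Expr.eval_eq_eq_one_iff] at h
      have hm : i < N ^ 3 := h.1
      exact .guess hr hi hm (by simpa [Nat.mod_eq_of_lt hm] using h.2)
    · exact edge_or_dead (S.pass r) rfl fun h =>
        .pass hr hi ((Expr.eval_le_eq_one_iff ..).1 h)
    · exact edge_or_dead (S.decrease r j) rfl fun h =>
        .decrease hr hj ((Expr.eval_le_eq_one_iff ..).1 h)
    · refine edge_or_dead (S.turn r j) rfl fun h => .turn hr hj hi ?_
      simp only [turn, Expr.eval_mul, mul_eq_one, eval_digitGuard] at h
      exact Fin.forall_fin_succ.2 ⟨h.1, Fin.forall_fin_two.2 h.2⟩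
    · refine edge_or_dead (S.increase r j) rfl fun h => ?_
      have hle : N ^ 3 ≤ i := (Expr.eval_le_eq_one_iff ..).1 h
      obtain ⟨i, rfl⟩ := Nat.exists_eq_add_of_le' hle
      simpa [increase, State.map] using Edge.increase (T := T) hr hj hi
    · exact edge_or_dead (S.next r j) rfl fun h =>
        .next hr hj hi ((Expr.eval_le_eq_one_iff ..).1 h)

/-- The states of the VASS of a hypergraph with `N` vertices. -/
def IsState (N : ℕ) : State ℕ → Prop
  | check r => r ≤ S.R
  | down r j i => r < S.R ∧ j ≤ S.d ∧ i < S.numIndices N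
  | up r j i => r < S.R ∧ j < S.d ∧ i < S.numIndices N
  | drain s => s ≤ S.R
  | dead i => i < S.numIndices N

/-- The number of a state, where `I` is the number of indices of each family of states. It is a
natural number, or an expression when a program writes the transitions. -/
def code {α : Type} [NatCast α] [Add α] [Mul α] (I : α) : State α → α
  | check r => (r : α)
  | drain s => ((S.R + 1 + s : ℕ) : α)
  | down r j i => ((2 * S.R + 2 : ℕ) : α) + ((r * (2 * S.d + 1) + 2 * j : ℕ) : α) * I + i
  | up r j i => ((2 * S.R + 2 : ℕ) : α) + ((r * (2 * S.d + 1) + (2 * j + 1) : ℕ) : α) * I + i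
  | dead i => ((2 * S.R + 2 : ℕ) : α) + ((S.R * (2 * S.d + 1) : ℕ) : α) * I + i

/-- The number of states of the VASS of a hypergraph with `N` vertices. -/
def numStates (N : ℕ) : ℕ :=
  2 * S.R + 2 + (S.R * (2 * S.d + 1) + 1 + S.pad) * S.numIndices N

theorem eval_code (ρ : Fin 5 → ℕ) (I : Expr) (s : State Expr) :
    (S.code I s).eval ρ = S.code (I.eval ρ) (s.map (Expr.eval ρ)) := by
  cases s <;> simp [code, State.map]

theorem Edge.isState {s s' : State ℕ} {x : ℕ → ℤ} {y : ℤ} (h : S.Edge N T s x y s') :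
    S.IsState N s ∧ S.IsState N s' := by
  cases h <;> grind [IsState]

theorem code_lt {s : State ℕ} (hs : S.IsState N s) :
    S.code (S.numIndices N) s < S.numStates N := by
  have hblock : ∀ a ≤ S.R * (2 * S.d + 1), ∀ i < S.numIndices N,
      2 * S.R + 2 + a * S.numIndices N + i < S.numStates N := by
    intro a ha i hi
    rw [numStates, add_assoc]
    exact Nat.add_lt_add_left (mul_add_lt_mul_of_lt (by omega) hi) _
  cases s with
  | check r =>
    simp only [IsState, code, numStates, Nat.cast_id] at *
    omega
  | drain s =>
    simp only [IsState, code, numStates, Nat.cast_id] at *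
    omega
  | dead i => exact hblock _ le_rfl i hs
  | down r j i => exact hblock _ (mul_add_lt_mul_of_lt hs.1 (by grind [IsState])).le i hs.2.2
  | up r j i => exact hblock _ (mul_add_lt_mul_of_lt hs.1 (by grind [IsState])).le i hs.2.2

theorem code_injOn : Set.InjOn (S.code (S.numIndices N)) {s | S.IsState N s} := by
  have hblock : ∀ {a b i j}, i < S.numIndices N → j < S.numIndices N →
      2 * S.R + 2 + a * S.numIndices N + i = 2 * S.R + 2 + b * S.numIndices N + j →
      a = b ∧ i = j := fun hi hj h => mul_add_inj hi hj (by omega)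
  have hfamily : ∀ {r r' k k'}, k < 2 * S.d + 1 → k' < 2 * S.d + 1 →
      r * (2 * S.d + 1) + k = r' * (2 * S.d + 1) + k' → r = r' ∧ k = k' := mul_add_inj
  have hlast : ∀ {r k}, r < S.R → k < 2 * S.d + 1 →
      r * (2 * S.d + 1) + k < S.R * (2 * S.d + 1) := mul_add_lt_mul_of_lt
  rintro s hs s' hs' h
  cases s <;> cases s' <;>
    simp only [code, IsState, Nat.cast_id, Set.mem_ofPred_eq] at h hs hs'
  case check.check | check.drain | drain.check | drain.drain | dead.dead => grind
  case down.down | down.up | up.down | up.up =>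
    obtain ⟨hrj, rfl⟩ := hblock hs.2.2 hs'.2.2 h
    obtain ⟨rfl, hj⟩ := hfamily (by omega) (by omega) hrj
    grind
  case down.dead | up.dead =>
    exact absurd (hblock hs.2.2 hs' h).1 (hlast hs.1 (by omega)).ne
  case dead.down | dead.up =>
    exact absurd (hblock hs hs'.2.2 h).1 (hlast hs'.1 (by omega)).ne'
  all_goals omega

theorem vec_inj {x x' : ℕ → ℤ} {y y' : ℤ} :
    S.vec x y = S.vec x' y' ↔ (∀ j < S.d, x j = x' j) ∧ y = y' := by
  constructor
  · intro h
    refine ⟨fun j hj => ?_, ?_⟩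
    · simpa [vec, hj] using congrFun h ⟨j, hj.trans S.d_lt_D⟩
    · simpa [vec] using congrFun h ⟨S.d, S.d_lt_D⟩
  · rintro ⟨hx, rfl⟩
    funext i
    by_cases hi : i.val < S.d <;> simp [vec, hi, hx]

/-- What distinguishes the members of a list of families of transitions: the source without its
index, and the vector. -/
def key {ι : Type} (s : State ι) (x : Fin S.D → ℤ) : State Unit × (Fin S.D → ℤ) :=
  (s.map fun _ => (), x)

theorem key_eval (ρ : Fin 5 → ℕ) (t : Rule S.D) :
    S.key (t.eval ρ).1 (t.eval ρ).2.1 = S.key t.src t.vec := by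
  simp only [Rule.eval, key]
  cases t.src <;> rfl

theorem nodup_map_key_headerRules : (S.headerRules.map fun t => S.key t.src t.vec).Nodup := by
  have single_inj {z : ℤ} (hz : z ≠ 0) {j j' : ℕ} (hj : j < S.d)
      (h : S.vec (Pi.single j z) 0 = S.vec (Pi.single j' z) 0) : j = j' := by
    have := (S.vec_inj.1 h).1 j hj
    grind
  simp only [headerRules, List.map_append, List.nodup_append', List.map_map]
  refine ⟨List.nodup_range.map_on ?_, ⟨List.nodup_range.map_on ?_,
    ⟨List.nodup_range.map ?_, List.nodup_singleton _, ?_⟩, ?_⟩, ?_⟩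
  · intro j hj j' _ h
    exact single_inj one_ne_zero (List.mem_range.1 hj) (Prod.mk.inj h).2
  · intro j hj j' _ h
    refine single_inj (neg_ne_zero.2 one_ne_zero) (List.mem_range.1 hj) ?_
    have hvec : S.vec (-Pi.single j 1) 0 = S.vec (-Pi.single j' 1) 0 := (Prod.mk.inj h).2
    rwa [← Pi.single_neg, ← Pi.single_neg] at hvec
  · intro s s' h
    simpa [discharge, key, State.map] using h
  · simp [discharge, leave, key, State.map]
  · simp [List.disjoint_left, enter, discharge, leave, key, State.map]
  · have hload : ∀ j < S.d, ∀ j' < S.d, S.R = 0 →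
        ∃ k < S.d, (-Pi.single j' 1 : ℕ → ℤ) k ≠ (Pi.single j 1 : ℕ → ℤ) k :=
      fun j hj j' _ _ => ⟨j, hj, by rw [Pi.neg_apply, Pi.single_eq_same, Pi.single_apply]; grind⟩
    simpa [List.disjoint_left, load, enter, discharge, leave, key, State.map, vec_inj] using hload

theorem nodup_map_key_bodyRules : (S.bodyRules.map fun t => S.key t.src t.vec).Nodup := by
  rw [bodyRules, List.map_flatMap]
  refine nodup_flatMap_of_key (fun k => match k.1 with
    | check r | down r _ _ | up r _ _ => r
    | _ => 0) List.nodup_range (fun r _ => ?_) fun r _ => ?_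
  · simp only [List.forall_mem_map, List.forall_mem_append, List.forall_mem_flatMap, counterRules,
      List.forall_mem_cons]
    simp [guess, pass, decrease, turn, increase, next, key, State.map]
  · rw [List.map_append, List.map_flatMap, List.nodup_append']
    refine ⟨?_, nodup_flatMap_of_key (fun k => match k.1 with
      | down _ j _ | up _ j _ => j
      | _ => 0) List.nodup_range (fun j _ => ?_) fun j hj => ?_, ?_⟩
    · simp [guess, pass, key, State.map]
    · simp [counterRules, decrease, turn, increase, next, key, State.map]
    · have hsingle : ∃ k < S.d, (Pi.single j 1 : ℕ → ℤ) k ≠ 0 := ⟨j, List.mem_range.1 hj, by simp⟩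
      simpa [counterRules, decrease, turn, increase, next, key, State.map, vec_inj] using hsingle
    · simp only [List.disjoint_left]
      simp [counterRules, guess, pass, decrease, turn, increase, next, key, State.map]
      omega

theorem key_ne_key : ∀ t ∈ S.headerRules, ∀ u ∈ S.bodyRules,
    S.key t.src t.vec ≠ S.key u.src u.vec := by
  let isBodyKey (k : State Unit × (Fin S.D → ℤ)) : Prop := match k.1 with
    | check _ => k.2 = S.vec 0 0
    | drain _ => False
    | _ => True
  have hheader : ∀ t ∈ S.headerRules, ¬ isBodyKey (S.key t.src t.vec) := by
    refine S.forall_mem_headerRules.2 ⟨fun j hj h => ?_, fun j hj h => ?_, fun _ _ => id, id⟩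
    all_goals simpa using (S.vec_inj.1 h).1 j hj
  have hbody : ∀ u ∈ S.bodyRules, isBodyKey (S.key u.src u.vec) :=
    S.forall_mem_bodyRules.2 fun r _ =>
      ⟨⟨rfl, trivial⟩, fun j _ => ⟨trivial, trivial, trivial, trivial⟩⟩
  exact fun t ht u hu heq => hheader t ht (heq ▸ hbody u hu)

theorem nodup_trans : (S.trans N T).Nodup := by
  have nodup_map_eval (ρ) {l : List (Rule S.D)} (hl : (l.map fun t => S.key t.src t.vec).Nodup) :
      (l.map (Rule.eval ρ)).Nodup := by
    refine List.Nodup.of_map (fun t => S.key t.1 t.2.1) ?_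
    simpa only [List.map_map, Function.comp_def, key_eval] using hl
  refine List.nodup_append'.2 ⟨nodup_map_eval _ S.nodup_map_key_headerRules,
    nodup_flatMap_of_key (fun t => match t.1, t.2.2 with
      | down _ _ i, _ | up _ _ i, _ | _, down _ _ i | _, dead i => i
      | _, _ => 0) List.nodup_range ?_ fun i _ => nodup_map_eval _ S.nodup_map_key_bodyRules, ?_⟩
  · simp only [List.forall_mem_map, List.mem_range]
    refine fun i _ => S.forall_mem_bodyRules.2 fun r _ =>
      ⟨⟨?_, rfl⟩, fun j _ => ⟨rfl, rfl, rfl, rfl⟩⟩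
    simp only [Rule.eval]
    split_ifs <;> rfl
  · simp only [List.disjoint_left, List.mem_flatMap, List.mem_map]
    rintro _ ⟨t, ht, rfl⟩ ⟨i, -, u, hu, heq⟩
    refine S.key_ne_key t ht u hu ?_
    rw [← S.key_eval (env N 0 (S.numIndices N) 0) t, ← heq, key_eval]

theorem unary_of_mem_trans :
    ∀ t ∈ S.trans N T, ∀ i, t.2.1 i = -1 ∨ t.2.1 i = 0 ∨ t.2.1 i = 1 := by
  refine forall_mem_trans.2 ⟨S.forall_mem_headerRules.2 ?_, fun i _ => S.forall_mem_bodyRules.2 ?_⟩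
  all_goals
    simp only [Rule.eval, load, enter, discharge, leave, guess, pass, decrease, turn, increase,
      next, vec, Pi.single_apply, Pi.neg_apply, Pi.zero_apply]
    grind

theorem isState_of_mem_trans : ∀ t ∈ S.trans N T, S.IsState N t.1 ∧ S.IsState N t.2.2 := by
  refine fun t ht => ⟨?_, ?_⟩
  · revert t
    refine forall_mem_trans.2 ⟨S.forall_mem_headerRules.2 ?_,
      fun i hi => S.forall_mem_bodyRules.2 ?_⟩
    · simp only [Rule.eval, load, enter, discharge, leave, State.map, IsState]
      grind
    · simp only [Rule.eval, guess, pass, decrease, turn, increase, next, State.map, IsState,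
        Expr.eval_var, env_apply_two, hi, and_true]
      grind
  · rcases edge_or_dead_of_mem_trans t ht with ⟨x, y, -, hedge⟩ | ⟨i, hi, hdead⟩
    · exact hedge.isState.2
    · rwa [hdead]

/-- The VASS of a hypergraph with `N` vertices and adjacency tensor `T`. -/
def toLabelledVASS (N : ℕ) (T : ℕ → ℕ) : LabelledVASS (State ℕ) S.D where
  numStates := S.numStates N
  states := {s | S.IsState N s}
  code := S.code (S.numIndices N)
  code_lt := fun _ => code_lt
  code_injOn := code_injOn
  trans := S.trans N T
  trans_ne_nil := List.ne_nil_of_mem (mem_trans_of_edge .leave)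
  trans_nodup := nodup_trans
  src_mem := fun t ht => (isState_of_mem_trans t ht).1
  dst_mem := fun t ht => (isState_of_mem_trans t ht).2
  unary := unary_of_mem_trans

end Shape

/-! ### Soundness of the reduction -/

theorem sum_div_pow_mod_mul_pow (b m n : ℕ) :
    ∑ k ∈ Finset.range n, m / b ^ k % b * b ^ k = m % b ^ n := by
  induction n with
  | zero => rw [Finset.sum_range_zero, pow_zero, Nat.mod_one]
  | succ n ih => rw [Finset.sum_range_succ, ih, Nat.mod_pow_succ, mul_comm (b ^ n)]

theorem mod_pow_div_pow_mod {k n : ℕ} (hkn : k < n) (b m : ℕ) :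
    m % b ^ n / b ^ k % b = m / b ^ k % b := by
  obtain ⟨l, rfl⟩ := Nat.exists_eq_add_of_le hkn
  rw [pow_add, pow_succ, mul_assoc, Nat.mod_mul_right_div_self, Nat.mod_mul_right_mod]

namespace Shape

variable (S : Shape) (N : ℕ) (T : ℕ → ℕ)

open State

/-- The vertex encoded at a position of a counter: the digit of `c p.1` to the base `N` that
belongs to `N ^ p.2`. -/
def vertex (c : ℕ → ℕ) (p : ℕ × ℕ) : ℕ := c p.1 / N ^ p.2 % N

/-- The sum of the first `d` counters. -/
def sum (c : ℕ → ℕ) : ℕ := ∑ j ∈ Finset.range S.d, c j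

/-- The entry of the adjacency tensor at the triple `r` of the vertices encoded by `h` is `1`. -/
def Check (r : ℕ) (h : ℕ → ℕ) : Prop :=
  T (∑ σ : Fin 3, vertex N h (S.tri r σ) * N ^ σ.val) = 1

/-- What is known if the first `j` counters, with the values `h`, have been compared with the guess
`m` in check `r`, while the guessed values of the counters in all checks add up to `z`. Every
guess is at most the value of the counter; only if `z` is the largest possible sum were all the
guesses right, and only then do the comparisons say something about `h`. -/
def Good (r j m : ℕ) (h : ℕ → ℕ) (z : ℕ) : Prop :=
  z ≤ r * S.sum h + ∑ k ∈ Finset.range j, h k ∧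
    (z = r * S.sum h + ∑ k ∈ Finset.range j, h k →
      (∀ r' < r, S.Check N T r' h) ∧ T m = 1 ∧
        ∀ σ : Fin 3, (S.tri r σ).1 < j → vertex N h (S.tri r σ) = m / N ^ σ.val % N)

/-- The invariant of all runs from state `check 0` with empty counters, where `c` are the values of
the first `d` counters and `z` is that of the next one. In the states `check S.R` and `drain s`
the checks speak about the values `h` that the counters had before they were drained. -/
def Inv : State ℕ → (ℕ → ℕ) → ℕ → Prop
  | check r, c, z => ∃ h, (r < S.R → h = c) ∧ z ≤ r * S.sum c ∧
      (z = r * S.sum c → ∀ r' < r, S.Check N T r' h)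
  | down r j i, c, z => ∃ z₀, z = z₀ + i / N ^ 3 ∧
      S.Good N T r j (i % N ^ 3) (c + Pi.single j (i / N ^ 3)) z₀
  | up r j i, c, z => S.Good N T r (j + 1) (i % N ^ 3) (c + Pi.single j (i / N ^ 3)) z
  | drain s, c, z => ∃ h, z ≤ S.R * S.sum c + s ∧
      (z = S.R * S.sum c + s → ∀ r < S.R, S.Check N T r h)
  | dead _, _, _ => True

variable {S N T}

theorem sum_add_single {j : ℕ} (hj : j < S.d) (c : ℕ → ℕ) (g : ℕ) :
    S.sum (c + Pi.single j g) = S.sum c + g := by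
  simp only [sum, Pi.add_apply, Finset.sum_add_distrib, Pi.single_apply, Finset.sum_ite_eq',
    Finset.mem_range, hj, if_true]

theorem check_of_vertex_eq {r m : ℕ} {h : ℕ → ℕ} (hT : T (m % N ^ 3) = 1)
    (hvertex : ∀ σ, vertex N h (S.tri r σ) = m % N ^ 3 / N ^ σ.val % N) : S.Check N T r h := by
  simp only [Check, hvertex]
  rwa [Fin.sum_univ_eq_sum_range fun k => m % N ^ 3 / N ^ k % N * N ^ k,
    sum_div_pow_mod_mul_pow, Nat.mod_mod]

namespace Good

variable {r j m z : ℕ} {h : ℕ → ℕ}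

theorem succ (hgood : S.Good N T r j m h z) {g : ℕ} (hle : g ≤ h j)
    (hvertex : g = h j → ∀ σ : Fin 3, (S.tri r σ).1 = j →
      vertex N h (S.tri r σ) = m / N ^ σ.val % N) :
    S.Good N T r (j + 1) m h (z + g) := by
  refine ⟨?_, fun heq => ?_⟩ <;> rw [Finset.sum_range_succ] at *
  · have := hgood.1
    omega
  · have := hgood.1
    obtain ⟨hcheck, hT, hprev⟩ := hgood.2 (by omega)
    refine ⟨hcheck, hT, fun σ hσ => ?_⟩
    rcases Nat.lt_succ_iff_lt_or_eq.1 hσ with hlt | heq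
    · exact hprev σ hlt
    · exact hvertex (by omega) σ heq

theorem check_of_eq (hgood : S.Good N T r S.d (m % N ^ 3) h z) (hr : r < S.R)
    (heq : z = (r + 1) * S.sum h) : ∀ r' < r + 1, S.Check N T r' h := by
  obtain ⟨hcheck, hT, hvertex⟩ := hgood.2 (by rw [heq, add_one_mul]; rfl)
  intro r' hr'
  rcases Nat.lt_succ_iff_lt_or_eq.1 hr' with hlt | rfl
  · exact hcheck r' hlt
  · exact check_of_vertex_eq hT fun σ => hvertex σ (S.tri_lt _ hr σ).1

end Good

theorem Inv.turn {r j i z : ℕ} {c : ℕ → ℕ} (hinv : S.Inv N T (down r j i) c z)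
    (hdigit : ∀ σ : Fin 3, (S.tri r σ).1 = j →
      i / N ^ (3 + (S.tri r σ).2) % N = i / N ^ σ.val % N) :
    S.Inv N T (up r j i) c z := by
  obtain ⟨z₀, rfl, hgood⟩ := hinv
  refine hgood.succ (by simp) fun hg σ hσ => ?_
  rw [mod_pow_div_pow_mod σ.isLt, ← hdigit σ hσ, vertex, hσ, ← hg, pow_add, Nat.div_div_eq_div_mul]

theorem Inv.decrease {r j i z : ℕ} {c : ℕ → ℕ} (hN : 0 < N ^ 3)
    (hinv : S.Inv N T (down r j i) (c + Pi.single j 1) z) :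
    S.Inv N T (down r j (i + N ^ 3)) c (z + 1) := by
  obtain ⟨z₀, rfl, hgood⟩ := hinv
  rw [add_assoc c, ← Pi.single_add, add_comm 1] at hgood
  refine ⟨z₀, ?_, ?_⟩
  · rw [Nat.add_div_right _ hN, add_assoc]
  · rwa [Nat.add_div_right _ hN, Nat.add_mod_right]

theorem Inv.increase {r j i z : ℕ} {c : ℕ → ℕ} (hN : 0 < N ^ 3)
    (hinv : S.Inv N T (up r j (i + N ^ 3)) c z) :
    S.Inv N T (up r j i) (c + Pi.single j 1) z := by
  rw [Inv, add_assoc, ← Pi.single_add, add_comm 1]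
  rwa [Inv, Nat.add_div_right _ hN, Nat.add_mod_right] at hinv

theorem Edge.eq_zero_of_le {s s' : State ℕ} {x : ℕ → ℤ} {y : ℤ} (h : S.Edge N T s x y s') {j : ℕ}
    (hj : S.d ≤ j) : x j = 0 := by
  cases h <;> simp only [Pi.zero_apply, Pi.neg_apply, Pi.single_apply] <;> grind

theorem pow_three_pos_of_lt_numIndices {i : ℕ} (hi : i < S.numIndices N) : 0 < N ^ 3 := by
  have hpos : 0 < N ^ S.K * N ^ 3 := by
    rw [← pow_add]
    exact (Nat.zero_le i).trans_lt hi
  exact Nat.pos_of_mul_pos_left hpos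

theorem Inv.guess {r m z : ℕ} {c : ℕ → ℕ} (hinv : S.Inv N T (check r) c z) (hr : r < S.R)
    (hm : m < N ^ 3) (hT : T m = 1) : S.Inv N T (down r 0 m) c z := by
  obtain ⟨h, hh, hle, heq⟩ := hinv
  obtain rfl := hh hr
  rw [Inv, Nat.div_eq_of_lt hm, Nat.mod_eq_of_lt hm, Pi.single_zero, add_zero]
  refine ⟨z, rfl, ?_⟩
  rw [Good, Finset.sum_range_zero, add_zero]
  exact ⟨hle, fun h => ⟨heq h, hT, fun σ hσ => absurd hσ (Nat.not_lt_zero _)⟩⟩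

theorem Inv.next {r j i z : ℕ} {c : ℕ → ℕ} (hinv : S.Inv N T (up r j i) c z) (hi : i < N ^ 3) :
    S.Inv N T (down r (j + 1) i) c z := by
  rw [Inv, Nat.div_eq_of_lt hi, Pi.single_zero, add_zero] at hinv
  rw [Inv, Nat.div_eq_of_lt hi, Pi.single_zero, add_zero]
  exact ⟨z, rfl, hinv⟩

theorem Inv.pass {r i z : ℕ} {c : ℕ → ℕ} (hinv : S.Inv N T (down r S.d i) c z) (hr : r < S.R)
    (hi : i < N ^ 3) : S.Inv N T (check (r + 1)) c z := by
  rw [Inv, Nat.div_eq_of_lt hi, Pi.single_zero, add_zero] at hinv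
  obtain ⟨z, rfl, hgood⟩ := hinv
  exact ⟨c, fun _ => rfl, (add_one_mul r (S.sum c)).symm ▸ hgood.1, hgood.check_of_eq hr⟩

theorem Inv.enter {j z : ℕ} {c : ℕ → ℕ} (hj : j < S.d)
    (hinv : S.Inv N T (check S.R) (c + Pi.single j 1) z) : S.Inv N T (drain S.R) c z := by
  obtain ⟨h, -, hle, heq⟩ := hinv
  rw [sum_add_single hj, mul_add_one] at hle heq
  exact ⟨h, hle, heq⟩

theorem eq_add_single_of_cast_eq {j : ℕ} {c c' : ℕ → ℕ}
    (h : ∀ k, (c' k : ℤ) = c k + (Pi.single j 1 : ℕ → ℤ) k) : c' = c + Pi.single j 1 := by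
  funext k
  have hk := h k
  rw [Pi.single_apply] at hk
  rw [Pi.add_apply, Pi.single_apply]
  split_ifs at hk ⊢ <;> omega

theorem Inv.of_edge {s s' : State ℕ} {x : ℕ → ℤ} {y : ℤ} {c c' : ℕ → ℕ} {z z' : ℕ}
    (hinv : S.Inv N T s c z) (hedge : S.Edge N T s x y s')
    (hc : ∀ j, (c' j : ℤ) = c j + x j) (hz : (z' : ℤ) = z + y) : S.Inv N T s' c' z' := by
  have eq_of_zero (h : x = 0) : c' = c := funext fun k => by simpa [h] using hc k
  have eq_add_single (j) (h : x = Pi.single j 1) : c' = c + Pi.single j 1 :=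
    eq_add_single_of_cast_eq fun k => h ▸ hc k
  have eq_sub_single (j) (h : x = -Pi.single j 1) : c = c' + Pi.single j 1 :=
    eq_add_single_of_cast_eq fun k => by rw [hc k, h, Pi.neg_apply, neg_add_cancel_right]
  have hz_eq (h : y = 0) : z' = z := by omega
  cases hedge with
  | load hj =>
    obtain ⟨_, -, hle, -⟩ := hinv
    exact ⟨c', fun _ => rfl, by omega, by simp⟩
  | guess hr _ hm hT => exact eq_of_zero rfl ▸ hz_eq rfl ▸ hinv.guess hr hm hT
  | decrease hr hj hi =>
    obtain rfl : z' = z + 1 := by omega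
    exact Inv.decrease (pow_three_pos_of_lt_numIndices hi) (eq_sub_single _ rfl ▸ hinv)
  | turn hr hj hi hdigit => exact eq_of_zero rfl ▸ hz_eq rfl ▸ hinv.turn hdigit
  | increase hr hj hi =>
    exact eq_add_single _ rfl ▸ hz_eq rfl ▸ hinv.increase (pow_three_pos_of_lt_numIndices hi)
  | next hr hj hI hi => exact eq_of_zero rfl ▸ hz_eq rfl ▸ hinv.next hi
  | pass hr hI hi => exact eq_of_zero rfl ▸ hz_eq rfl ▸ hinv.pass hr hi
  | enter hj => exact hz_eq rfl ▸ Inv.enter hj (eq_sub_single _ rfl ▸ hinv)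
  | discharge hs =>
    obtain ⟨h, hle, heq⟩ := hinv
    exact eq_of_zero rfl ▸ ⟨h, by omega, fun _ => heq (by omega)⟩
  | leave =>
    obtain ⟨h, hle, heq⟩ := hinv
    exact eq_of_zero rfl ▸ hz_eq rfl ▸ ⟨h, fun hR => absurd hR (lt_irrefl _), hle, heq⟩

/-- The values of the first `d` counters, as a function on `ℕ`. -/
def counters (u : Fin S.D → ℕ) (j : ℕ) : ℕ := if hj : j < S.d then u ⟨j, hj.trans S.d_lt_D⟩ else 0

/-- The value of the counter that adds up the guesses. -/
def total (u : Fin S.D → ℕ) : ℕ := u ⟨S.d, S.d_lt_D⟩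

theorem Inv.step {B : ℕ} {a b : State ℕ × (Fin S.D → ℕ)}
    (hinv : S.Inv N T a.1 (S.counters a.2) (S.total a.2))
    (hstep : (S.toLabelledVASS N T).Step B a b) :
    S.Inv N T b.1 (S.counters b.2) (S.total b.2) := by
  obtain ⟨-, -, v, hmem, hv⟩ := hstep
  rcases edge_or_dead_of_mem_trans _ hmem with ⟨x, y, rfl, hedge⟩ | ⟨i, -, hdead⟩
  · refine hinv.of_edge hedge (fun j => ?_) ?_
    · by_cases hj : j < S.d
      · simpa [counters, vec, hj] using hv ⟨j, hj.trans S.d_lt_D⟩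
      · simp [counters, hj, hedge.eq_zero_of_le (not_lt.1 hj)]
    · simpa [total, vec] using hv ⟨S.d, S.d_lt_D⟩
  · rw [show b.1 = dead i from hdead]
    trivial

theorem exists_check_of_reachable {B : ℕ}
    (h : Relation.ReflTransGen ((S.toLabelledVASS N T).Step B) (check 0, fun _ => 0)
      (check S.R, fun _ => 0)) : ∃ c, ∀ r < S.R, S.Check N T r c := by
  have hcounters : S.counters (fun _ => 0) = 0 := funext fun j => by simp [counters]
  have hinv : ∀ b, Relation.ReflTransGen ((S.toLabelledVASS N T).Step B) (check 0, fun _ => 0) b →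
      S.Inv N T b.1 (S.counters b.2) (S.total b.2) := by
    intro b hb
    induction hb with
    | refl =>
      exact ⟨_, fun _ => rfl, Nat.zero_le _, fun _ r' hr' => absurd hr' (Nat.not_lt_zero r')⟩
    | tail _ hstep ih => exact ih.step hstep
  obtain ⟨c, -, -, hcheck⟩ := hinv _ h
  exact ⟨c, hcheck (by simp [hcounters, total, sum])⟩

end Shape

/-! ### Completeness of the reduction -/

namespace Shape

variable {S : Shape} {N : ℕ} {T : ℕ → ℕ}

open State

variable (S) in
/-- The counters with the values `c` for the first `d` counters and `z` for the next one. -/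
def config (c : ℕ → ℕ) (z : ℕ) : Fin S.D → ℕ := fun i =>
  if i.val < S.d then c i.val else if i.val = S.d then z else 0

variable (S) in
/-- The values `c` of the first `d` counters and `z` of the next one are at most `B`. -/
def Bounded (B : ℕ) (c : ℕ → ℕ) (z : ℕ) : Prop := (∀ j < S.d, c j ≤ B) ∧ z ≤ B

variable (S N T) in
/-- Reachability in the `B`-bounded VASS of a hypergraph. -/
def Reach (B : ℕ) : State ℕ × (Fin S.D → ℕ) → State ℕ × (Fin S.D → ℕ) → Prop :=
  Relation.ReflTransGen ((S.toLabelledVASS N T).Step B)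

variable {B : ℕ} {c c' : ℕ → ℕ} {z z' : ℕ}

theorem Bounded.mono (hb : S.Bounded B c' z') (hc : ∀ j < S.d, c j ≤ c' j) (hz : z ≤ z') :
    S.Bounded B c z :=
  ⟨fun j hj => (hc j hj).trans (hb.1 j hj), hz.trans hb.2⟩

theorem Bounded.config_le (hb : S.Bounded B c z) (i) : S.config c z i ≤ B := by
  unfold config
  split_ifs with hi
  exacts [hb.1 _ hi, hb.2, Nat.zero_le B]

theorem Edge.reach {s s' : State ℕ} {x : ℕ → ℤ} {y : ℤ} (hedge : S.Edge N T s x y s')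
    (hb : S.Bounded B c z) (hb' : S.Bounded B c' z') (hc : ∀ j, (c' j : ℤ) = c j + x j)
    (hz : (z' : ℤ) = z + y) : S.Reach N T B (s, S.config c z) (s', S.config c' z') := by
  refine .single ⟨hb.config_le, hb'.config_le, S.vec x y, mem_trans_of_edge hedge, fun i => ?_⟩
  simp only [config, vec]
  split_ifs
  exacts [hc i, hz, rfl]

theorem Edge.reach_of_zero {s s' : State ℕ} (hedge : S.Edge N T s 0 0 s') (hb : S.Bounded B c z) :
    S.Reach N T B (s, S.config c z) (s', S.config c z) :=
  hedge.reach hb hb (fun _ => (add_zero _).symm) (add_zero _).symm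

theorem add_mul_lt_numIndices {m g : ℕ} (hm : m < N ^ 3) (hg : g < N ^ S.K) :
    m + g * N ^ 3 < S.numIndices N := by
  rw [numIndices, pow_add, add_comm]
  exact mul_add_lt_mul_of_lt hg hm

section Check

variable {r j m g : ℕ} (hr : r < S.R) (hj : j < S.d) (hm : m < N ^ 3) (hK : c j < N ^ S.K)

include hr hj hm hK

theorem reach_down (hg : g ≤ c j) (hb : S.Bounded B c (z + c j)) :
    S.Reach N T B (down r j m, S.config c z)
      (down r j (m + g * N ^ 3), S.config (Function.update c j (c j - g)) (z + g)) := by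
  have hbounded (g) (hg : g ≤ c j) :
      S.Bounded B (Function.update c j (c j - g)) (z + g) :=
    hb.mono (fun k _ => by grind) (by omega)
  induction g with
  | zero => simpa [Reach] using Relation.ReflTransGen.refl
  | succ g ih =>
    refine (ih (by omega)).trans ?_
    have hlt := add_mul_lt_numIndices (S := S) hm (hg.trans_lt hK)
    rw [add_one_mul, ← add_assoc] at hlt ⊢
    refine (Edge.decrease hr hj hlt).reach (hbounded g (by omega)) (hbounded _ hg)
      (fun k => ?_) (by push_cast; ring)
    rw [Pi.neg_apply, Pi.single_apply]
    grind

theorem reach_up (hg : g ≤ c j) (hb : S.Bounded B c z) :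
    S.Reach N T B (up r j (m + g * N ^ 3), S.config (Function.update c j (c j - g)) z)
      (up r j m, S.config c z) := by
  have hbounded (g) : S.Bounded B (Function.update c j (c j - g)) z :=
    hb.mono (fun k _ => by grind) le_rfl
  induction g with
  | zero => simpa [Reach] using Relation.ReflTransGen.refl
  | succ g ih =>
    refine Relation.ReflTransGen.trans ?_ (ih (by omega))
    have hlt := add_mul_lt_numIndices (S := S) hm (hg.trans_lt hK)
    rw [add_one_mul, ← add_assoc] at hlt ⊢
    refine (Edge.increase hr hj hlt).reach (hbounded _) (hbounded _) (fun k => ?_) (by simp)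
    rw [Pi.single_apply]
    grind

theorem reach_counter (hb : S.Bounded B c (z + c j))
    (hvertex : ∀ σ : Fin 3, vertex N c (S.tri r σ) = m / N ^ σ.val % N) :
    S.Reach N T B (down r j m, S.config c z) (down r (j + 1) m, S.config c (z + c j)) := by
  have hlt := add_mul_lt_numIndices (S := S) hm hK
  have hdigit (σ : Fin 3) (hσ : (S.tri r σ).1 = j) :
      (m + c j * N ^ 3) / N ^ (3 + (S.tri r σ).2) % N = (m + c j * N ^ 3) / N ^ σ.val % N := by
    rw [← mod_pow_div_pow_mod σ.isLt, Nat.add_mul_mod_self_right, Nat.mod_eq_of_lt hm, ← hvertex,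
      pow_add, ← Nat.div_div_eq_div_mul, Nat.add_mul_div_right _ _ (Nat.zero_lt_of_lt hm),
      Nat.div_eq_of_lt hm, zero_add, vertex, hσ]
  exact (reach_down hr hj hm hK le_rfl hb).trans <|
    ((Edge.turn hr hj hlt hdigit).reach_of_zero (hb.mono (fun k _ => by grind) le_rfl)).trans <|
    (reach_up hr hj hm hK le_rfl hb).trans <|
    (Edge.next hr hj ((Nat.le_add_right _ _).trans_lt hlt) hm).reach_of_zero hb

end Check

theorem reach_counters {r m : ℕ} (hr : r < S.R) (hm : m < N ^ 3) (hK : ∀ j < S.d, c j < N ^ S.K)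
    (hb : S.Bounded B c (z + S.sum c))
    (hvertex : ∀ σ : Fin 3, vertex N c (S.tri r σ) = m / N ^ σ.val % N) {j : ℕ} (hj : j ≤ S.d) :
    S.Reach N T B (down r 0 m, S.config c z)
      (down r j m, S.config c (z + ∑ k ∈ Finset.range j, c k)) := by
  induction j with
  | zero => exact .refl
  | succ j ih =>
    have hsum : ∑ k ∈ Finset.range (j + 1), c k ≤ S.sum c :=
      Finset.sum_le_sum_of_subset (Finset.range_subset_range.2 hj)
    rw [Finset.sum_range_succ, ← add_assoc] at *
    exact (ih (Nat.le_of_succ_le hj)).trans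
      (reach_counter hr hj hm (hK j hj) (hb.mono (fun _ _ => le_rfl) (by omega)) hvertex)

theorem reach_check_succ {r : ℕ} (hN : 0 < N) (hr : r < S.R) (hK : ∀ j < S.d, c j < N ^ S.K)
    (hb : S.Bounded B c (z + S.sum c)) (hcheck : S.Check N T r c) :
    S.Reach N T B (check r, S.config c z) (check (r + 1), S.config c (z + S.sum c)) := by
  let v (σ : Fin 3) : Fin N := ⟨vertex N c (S.tri r σ), Nat.mod_lt _ hN⟩
  let m := finFunctionFinEquiv v
  have hlt : m.val < S.numIndices N :=
    m.isLt.trans_le (Nat.pow_le_pow_right hN (Nat.le_add_left _ _))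
  have hT : T m = 1 := by rwa [finFunctionFinEquiv_apply]
  have hvertex (σ : Fin 3) : vertex N c (S.tri r σ) = m / N ^ σ.val % N :=
    (congrArg Fin.val (congrFun (finFunctionFinEquiv.symm_apply_apply v) σ)).symm
  exact ((Edge.guess hr hlt m.isLt hT).reach_of_zero
      (hb.mono (fun _ _ => le_rfl) (Nat.le_add_right _ _))).trans <|
    (reach_counters hr m.isLt hK hb hvertex le_rfl).trans <|
    (Edge.pass hr hlt m.isLt).reach_of_zero hb

theorem reach_check (hN : 0 < N) (hK : ∀ j < S.d, c j < N ^ S.K)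
    (hb : S.Bounded B c (S.R * S.sum c)) (hcheck : ∀ r < S.R, S.Check N T r c) {r : ℕ}
    (hr : r ≤ S.R) :
    S.Reach N T B (check 0, S.config c 0) (check r, S.config c (r * S.sum c)) := by
  induction r with
  | zero => rw [zero_mul]; exact .refl
  | succ r ih =>
    have hle := Nat.mul_le_mul_right (S.sum c) hr
    rw [add_one_mul] at hle ⊢
    exact (ih (Nat.le_of_succ_le hr)).trans
      (reach_check_succ hN hr hK (hb.mono (fun _ _ => le_rfl) hle) (hcheck r hr))

theorem counter_induction {p : (ℕ → ℕ) → Prop} (zero : ∀ c, (∀ j < S.d, c j = 0) → p c)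
    (add_single : ∀ c, ∀ j < S.d, p c → p (c + Pi.single j 1)) (c : ℕ → ℕ) : p c := by
  induction hn : S.sum c generalizing c with
  | zero => exact zero c fun j hj => Finset.sum_eq_zero_iff.1 hn j (Finset.mem_range.2 hj)
  | succ n ih =>
    obtain ⟨j, hj, hcj⟩ := Finset.exists_ne_zero_of_sum_ne_zero (hn.trans_ne n.succ_ne_zero)
    obtain ⟨c, rfl⟩ : ∃ c', c = c' + Pi.single j 1 :=
      ⟨Function.update c j (c j - 1), by funext k; rw [Pi.add_apply, Pi.single_apply]; grind⟩
    rw [Finset.mem_range] at hj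
    rw [sum_add_single hj] at hn
    exact add_single c j hj (ih c (Nat.succ.inj hn))

theorem config_eq_zero (hc : ∀ j < S.d, c j = 0) : S.config c 0 = fun _ => 0 := by
  funext i
  unfold config
  split_ifs with hi
  exacts [hc i hi, rfl, rfl]

theorem reach_load (hb : S.Bounded B c 0) :
    S.Reach N T B (check 0, fun _ => 0) (check 0, S.config c 0) := by
  induction c using S.counter_induction with
  | zero c hc => rw [config_eq_zero hc]; exact .refl
  | add_single c j hj ih =>
    have hb' : S.Bounded B c 0 := hb.mono (fun _ _ => Nat.le_add_right _ _) le_rfl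
    refine (ih hb').trans ((Edge.load hj).reach hb' hb (fun k => ?_) rfl)
    simp [Pi.single_apply]

theorem reach_discharge {s : ℕ} (hs : s ≤ S.R) (hb : S.Bounded B c (z + s)) :
    S.Reach N T B (drain s, S.config c (z + s)) (drain 0, S.config c z) := by
  induction s with
  | zero => exact .refl
  | succ s ih =>
    have hb' : S.Bounded B c (z + s) := hb.mono (fun _ _ => le_rfl) (Nat.le_succ _)
    exact ((Edge.discharge hs).reach hb hb' (fun _ => (add_zero _).symm) (by push_cast; ring)).trans
      (ih (Nat.le_of_succ_le hs) hb')

theorem reach_drain (hb : S.Bounded B c (S.R * S.sum c)) :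
    S.Reach N T B (check S.R, S.config c (S.R * S.sum c)) (check S.R, fun _ => 0) := by
  induction c using S.counter_induction with
  | zero c hc =>
    have hsum : S.sum c = 0 := Finset.sum_eq_zero fun j hj => hc j (Finset.mem_range.1 hj)
    rw [hsum, mul_zero, config_eq_zero hc]
    exact .refl
  | add_single c j hj ih =>
    rw [sum_add_single hj, mul_add_one] at *
    have hb' : S.Bounded B c (S.R * S.sum c + S.R) :=
      hb.mono (fun _ _ => Nat.le_add_right _ _) le_rfl
    have hb'' : S.Bounded B c (S.R * S.sum c) := hb'.mono (fun _ _ => le_rfl) (Nat.le_add_right _ _)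
    refine ((Edge.enter hj).reach hb hb' (fun k => ?_) (add_zero _).symm).trans <|
      (reach_discharge le_rfl hb').trans <| (Edge.leave.reach_of_zero hb'').trans (ih hb'')
    simp [Pi.single_apply]

theorem reach_of_check (hN : 0 < N) (hK : ∀ j < S.d, c j < N ^ S.K)
    (hb : S.Bounded B c (S.R * S.sum c)) (hcheck : ∀ r < S.R, S.Check N T r c) :
    S.Reach N T B (check 0, fun _ => 0) (check S.R, fun _ => 0) :=
  (reach_load (hb.mono (fun _ _ => le_rfl) (Nat.zero_le _))).trans <|
    (reach_check hN hK hb hcheck le_rfl).trans (reach_drain hb)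

end Shape

/-! ### Hypercliques and triples of vertices -/

section Tensor

variable {n : ℕ} (H : Hypergraph (Fin n))

theorem length_encode3 : H.encode3.length = n ^ 3 + 1 := by
  have hrow (i : Fin n) : ((List.finRange n).flatMap fun j => (List.finRange n).map fun l =>
      open Classical in if ({i, j, l} : Set (Fin n)) ∈ H.edgeSet then 1 else 0).length = n * n := by
    rw [length_flatMap_of_forall_length_eq _ fun _ => List.length_map _, List.length_finRange]
  rw [Hypergraph.encode3, List.length_cons, length_flatMap_of_forall_length_eq _ hrow,
    List.length_finRange, pow_three]

/-- The entry of the adjacency tensor with number `m`. -/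
noncomputable def tensor (m : ℕ) : ℕ := H.encode3.getD (1 + m) 0

open Classical in
theorem tensor_apply (a b c : Fin n) :
    tensor H (a.val * (n * n) + (b.val * n + c.val)) =
      if ({a, b, c} : Set (Fin n)) ∈ H.edgeSet then 1 else 0 := by
  have hbc : b.val * n + c.val < n * n := mul_add_lt_mul_of_lt b.isLt c.isLt
  rw [tensor, Hypergraph.encode3, add_comm 1, List.getD_cons_succ,
    getD_flatMap_of_forall_length_eq _ _ (by simp) hbc,
    getD_flatMap_of_forall_length_eq _ _ (by simp) c.isLt]
  · simp
  · simp
  · intro i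
    rw [length_flatMap_of_forall_length_eq _ fun _ => List.length_map _, List.length_finRange]

theorem tensor_sum_eq_one_iff (v : Fin 3 → Fin n) :
    tensor H (∑ σ, (v σ).val * n ^ σ.val) = 1 ↔ Set.range v ∈ H.edgeSet := by
  have hsum : ∑ σ, (v σ).val * n ^ σ.val =
      (v 2).val * (n * n) + ((v 1).val * n + (v 0).val) := by
    simp only [Fin.sum_univ_three, Fin.val_zero, Fin.val_one, Fin.val_two]
    ring
  have hrange : ({v 2, v 1, v 0} : Set (Fin n)) = Set.range v := by
    ext x
    simp only [Set.mem_insert_iff, Set.mem_singleton_iff, Set.mem_range, Fin.exists_fin_succ,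
      IsEmpty.exists_iff, or_false, eq_comm (a := x)]
    tauto
  rw [hsum, tensor_apply, ← hrange]
  split_ifs with h <;> simp [h]

theorem tensor_le_one (m : ℕ) : tensor H m ≤ 1 := by
  have getD_le_one {l : List ℕ} (hl : ∀ x ∈ l, x ≤ 1) : l.getD m 0 ≤ 1 := by
    rcases lt_or_ge m l.length with h | h
    · rw [List.getD_eq_getElem _ _ h]
      exact hl _ (List.getElem_mem h)
    · rw [List.getD_eq_default _ _ h]
      exact zero_le_one
  rw [tensor, Hypergraph.encode3, add_comm, List.getD_cons_succ]
  refine getD_le_one ?_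
  simp only [List.forall_mem_flatMap, List.forall_mem_map]
  intro i _ j _ l _
  split_ifs <;> simp

theorem genInput_encode3 : WordRAM.GenInput n H.encode3 where
  getD_zero := rfl
  length_eq := length_encode3 H
  getD_succ_le_one := tensor_le_one H

end Tensor

theorem forall_range_embedding_iff {α : Type*} {μ : ℕ} {p : Set α → Prop} :
    (∀ e : Fin μ ↪ α, p (Set.range e)) ↔ ∀ s : Finset α, s.card = μ → p s := by
  constructor
  · intro h s hs
    have hrange := (s.equivFinOfCardEq hs).symm.surjective.range_comp (Subtype.val : s → α)
    rw [Subtype.range_coe] at hrange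
    exact hrange ▸ h ((s.equivFinOfCardEq hs).symm.toEmbedding.trans (.subtype _))
  · intro h e
    simpa using h (Finset.univ.map e) (by simp)

theorem hasHyperclique_iff_exists_forall_range_mem {V α : Type} [Fintype α] {H : Hypergraph V}
    {μ : ℕ} (hV : H.vertexSet = Set.univ) (hU : H.IsUniform μ) (hμ : 2 ≤ μ)
    (hα : μ ≤ Fintype.card α) :
    H.HasHyperclique μ (Fintype.card α) ↔
      ∃ v : α → V, ∀ e : Fin μ ↪ α, Set.range (v ∘ e) ∈ H.edgeSet := by
  classical
  have hrange (v : α → V) : (∀ e : Fin μ ↪ α, Set.range (v ∘ e) ∈ H.edgeSet) ↔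
      ∀ s : Finset α, s.card = μ → v '' s ∈ H.edgeSet := by
    simpa only [Set.range_comp] using forall_range_embedding_iff (p := fun s => v '' s ∈ H.edgeSet)
  simp only [hrange]
  constructor
  · rintro ⟨C, -, hC, hedge⟩
    let w : α ≃ C := Fintype.equivOfCardEq (by simp [hC])
    let v : α ↪ V := w.toEmbedding.trans (.subtype _)
    have hvC (s : Finset α) : s.map v ⊆ C := by
      simp [Finset.subset_iff, v]
    exact ⟨v, fun s hs => by simpa using hedge (s.map v) (hvC s) (by simpa using hs)⟩
  · rintro ⟨v, hedge⟩
    have hinj : Function.Injective v := by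
      intro p q hpq
      obtain ⟨s, hpqs, hs⟩ := Finset.exists_superset_card_eq (s := {p, q}) (n := μ)
        (Finset.card_le_two.trans hμ) hα
      have hinjOn : Set.InjOn v s := by
        rw [← Set.ncard_image_iff, (hU _ (hedge s hs)).2, Set.ncard_coe_finset, hs]
      exact hinjOn (hpqs (by simp)) (hpqs (by simp)) hpq
    refine ⟨Finset.univ.map ⟨v, hinj⟩, by simp [hV], by simp, fun e he hcard => ?_⟩
    obtain ⟨s, -, rfl⟩ := Finset.subset_map_iff.1 he
    simpa using hedge s (by simpa using hcard)

namespace Shape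

/-- The shape that checks all triples of different vertices, for `d` counters with `K` vertices
each. -/
noncomputable def ofTriples (d D K pad : ℕ) (hdD : d < D) : Shape where
  d := d
  D := D
  K := K
  R := Fintype.card (Fin 3 ↪ Fin d × Fin K)
  tri r σ :=
    if h : r < Fintype.card (Fin 3 ↪ Fin d × Fin K) then
      Prod.map Fin.val Fin.val ((Fintype.equivFin _).symm ⟨r, h⟩ σ)
    else (0, 0)
  pad := pad
  d_lt_D := hdD
  tri_lt r hr σ := by
    rw [dif_pos hr]
    exact ⟨Fin.isLt _, Fin.isLt _⟩

variable {d D K pad : ℕ} {hdD : d < D}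

theorem forall_tri_iff {p : (Fin 3 → ℕ × ℕ) → Prop} :
    (∀ r < (ofTriples d D K pad hdD).R, p ((ofTriples d D K pad hdD).tri r)) ↔
      ∀ e : Fin 3 ↪ Fin d × Fin K, p (Prod.map Fin.val Fin.val ∘ e) := by
  have htri : ∀ r : Fin (Fintype.card (Fin 3 ↪ Fin d × Fin K)),
      (ofTriples d D K pad hdD).tri r =
        Prod.map Fin.val Fin.val ∘ ⇑((Fintype.equivFin (Fin 3 ↪ Fin d × Fin K)).symm r) :=
    fun r => funext fun σ => dif_pos r.isLt
  rw [(Fintype.equivFin (Fin 3 ↪ Fin d × Fin K)).symm.surjective.forall]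
  simp only [← htri]
  exact (Fin.forall_iff (p := fun r => p ((ofTriples d D K pad hdD).tri r))).symm

variable {N : ℕ} {H : Hypergraph (Fin N)}

theorem forall_check_iff {c : ℕ → ℕ} {v : Fin d × Fin K → Fin N}
    (hv : ∀ p, (v p).val = vertex N c (Prod.map Fin.val Fin.val p)) :
    (∀ r < (ofTriples d D K pad hdD).R, (ofTriples d D K pad hdD).Check N (tensor H) r c) ↔
      ∀ e : Fin 3 ↪ Fin d × Fin K, Set.range (v ∘ e) ∈ H.edgeSet := by
  refine (forall_tri_iff (p := fun t =>
    tensor H (∑ σ, vertex N c (t σ) * N ^ σ.val) = 1)).trans (forall_congr' fun e => ?_)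
  simp only [Function.comp_apply, ← hv]
  exact tensor_sum_eq_one_iff H (v ∘ e)

theorem exists_bounded_check_of_range_mem {v : Fin d × Fin K → Fin N}
    (hv : ∀ e : Fin 3 ↪ Fin d × Fin K, Set.range (v ∘ e) ∈ H.edgeSet) :
    ∃ c : ℕ → ℕ, (∀ j < d, c j < N ^ K) ∧
      ∀ r < (ofTriples d D K pad hdD).R, (ofTriples d D K pad hdD).Check N (tensor H) r c := by
  let x (j : Fin d) : Fin (N ^ K) := finFunctionFinEquiv fun k => v (j, k)
  refine ⟨fun j => if hj : j < d then x ⟨j, hj⟩ else 0, fun j hj => ?_,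
    (forall_check_iff fun p => ?_).2 hv⟩
  · simp only [dif_pos hj]
    exact Fin.isLt _
  · have hdigit := congrFun (finFunctionFinEquiv.symm_apply_apply fun k => v (p.1, k)) p.2
    simp only [vertex, Prod.map_fst, dif_pos p.1.isLt]
    exact (congrArg Fin.val hdigit).symm

end Shape

/-! ### The reduction on a Word-RAM -/

namespace WordRAM.GenInput

variable {N : ℕ} {inp : List ℕ} (h : GenInput N inp) {w : ℕ} (hw : 4 * (Nat.log 2 N + 1) ≤ w)

include h hw

theorem length_lt : inp.length < 2 ^ w := by
  rw [h.length_eq]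
  calc N ^ 3 + 1 ≤ (N + 1) ^ 3 := Nat.pow_lt_pow_left N.lt_succ_self three_ne_zero
    _ ≤ (2 ^ (Nat.log 2 N + 1)) ^ 3 :=
      Nat.pow_le_pow_left (Nat.lt_pow_succ_log_self one_lt_two N) 3
    _ = 2 ^ (3 * (Nat.log 2 N + 1)) := by rw [mul_comm, pow_mul]
    _ < 2 ^ w := Nat.pow_lt_pow_right one_lt_two (by omega)

theorem lt_of_mem : ∀ x ∈ inp, x < 2 ^ w := by
  intro x hx
  obtain ⟨i, hi, rfl⟩ := List.mem_iff_getElem.1 hx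
  rw [← List.getD_eq_getElem _ 0]
  cases i with
  | zero =>
    rw [h.getD_zero]
    exact (Nat.lt_pow_succ_log_self one_lt_two N).trans_le
      (Nat.pow_le_pow_right two_pos (by omega))
  | succ i =>
    rw [add_comm]
    exact (h.getD_succ_le_one i).trans_lt (Nat.one_lt_two_pow (by omega))

end WordRAM.GenInput

namespace Shape

open WordRAM State

variable (S : Shape)

/-- The words that encode the transition of a family in an environment whose variable `3` is the
number of indices. -/
def ruleWords (t : Rule S.D) : List Expr :=
  S.code (.var 3) t.src :: ((List.ofFn fun i => (((t.vec i + 1).toNat : ℕ) : Expr)) ++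
    [.ite t.guard (S.code (.var 3) t.dst) (S.code (.var 3) (dead (.var 2)))])

/-- What the instance of a hypergraph begins with: its words that do not depend on an index. -/
def headerWords : List Expr :=
  [((2 * S.R + 2 : ℕ) : Expr) + ((S.R * (2 * S.d + 1) + 1 + S.pad : ℕ) : Expr) * .var 3,
    (S.headerRules.length : Expr) + .var 3 * (S.bodyRules.length : Expr)] ++
    (S.code (.var 3) (check 0) :: List.replicate S.D 0) ++
    (S.code (.var 3) (check S.R) :: List.replicate S.D 0) ++ S.headerRules.flatMap S.ruleWords

/-- The words of the instance of a hypergraph that belong to an index. -/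
def bodyWords : List Expr := S.bodyRules.flatMap S.ruleWords

/-- The instance that asks whether all checks can be passed. -/
def inst (B : ℕ → ℕ) (N : ℕ) (T : ℕ → ℕ) : BoundedReachInstance S.D B :=
  (S.toLabelledVASS N T).inst B (check 0) (check S.R)

variable {S} {N : ℕ} {T : ℕ → ℕ}

theorem map_eval_ruleWords {ρ : Fin 5 → ℕ} (hρ : ρ 3 = S.numIndices N) (t : Rule S.D) :
    (S.ruleWords t).map (Expr.eval ρ) = (S.toLabelledVASS N T).transWords (t.eval ρ) := by
  have hdst : (Expr.ite t.guard (S.code (.var 3) t.dst) (S.code (.var 3) (dead (.var 2)))).eval ρ =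
      S.code (S.numIndices N) (t.eval ρ).2.2 := by
    rw [Expr.eval_ite, eval_code, eval_code, Expr.eval_var, hρ, Rule.eval]
    split_ifs <;> rfl
  simp only [ruleWords, List.map_cons, List.map_append, List.map_ofFn, Function.comp_def,
    Expr.eval_natCast, List.map_nil, hdst, eval_code, Expr.eval_var, hρ]
  rfl

theorem length_trans :
    (S.trans N T).length = S.headerRules.length + S.numIndices N * S.bodyRules.length := by
  rw [trans, List.length_append, List.length_map,
    length_flatMap_of_forall_length_eq _ fun _ => List.length_map _, List.length_range]

theorem size_toLabelledVASS : (S.toLabelledVASS N T).size =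
    (S.R * (2 * S.d + 1) + 1 + S.pad + S.bodyRules.length) * N ^ (S.K + 3) +
      (2 * S.R + 2 + S.headerRules.length) := by
  change S.numStates N + (S.trans N T).length = _
  rw [length_trans, numStates, numIndices]
  ring

variable (S) in
theorem pad_mul_le_size (hN : 0 < N) : S.pad * N ^ S.K ≤ (S.toLabelledVASS N T).size := by
  rw [size_toLabelledVASS]
  exact (Nat.mul_le_mul (by omega) (Nat.pow_le_pow_right hN (Nat.le_add_right _ 3))).trans
    (Nat.le_add_right _ _)

theorem length_bodyWords_pos (hR : 0 < S.R) : 0 < S.bodyWords.length := by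
  have hguess : guess S 0 ∈ S.bodyRules := ((forall_mem_bodyRules S).1 (fun _ ht => ht) 0 hR).1.1
  refine List.length_pos_iff.2 fun h => ?_
  exact List.cons_ne_nil _ _ (List.flatMap_eq_nil_iff.1 h _ hguess)

theorem ofTriples_R_pos {d D K pad : ℕ} {hdD : d < D} (hdK : 3 ≤ d * K) :
    0 < (ofTriples d D K pad hdD).R :=
  Fintype.card_pos_iff.2 (Function.Embedding.nonempty_iff_card_le.2 (by simpa using hdK))

theorem genOutput_eq_encode (B : ℕ → ℕ) (inp : List ℕ) :
    genOutput (S.K + 3) S.headerWords S.bodyWords N inp =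
      (boundedReachability S.D B).encode (S.inst B N fun m => inp.getD (1 + m) 0) := by
  have hwords (i τ : ℕ) (l : List (Rule S.D)) :
      (l.flatMap S.ruleWords).map (Expr.eval (env N i (S.numIndices N) τ)) =
        (l.map (Rule.eval (env N i (S.numIndices N) τ))).flatMap
          (S.toLabelledVASS N fun m => inp.getD (1 + m) 0).transWords := by
    rw [List.map_flatMap, List.flatMap_map]
    exact List.flatMap_congr fun t _ => map_eval_ruleWords rfl t
  rw [inst, LabelledVASS.encode_inst B (Nat.zero_le _ : S.IsState N (check 0))
    (le_rfl : S.IsState N (check S.R))]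
  have htrans : (S.toLabelledVASS N fun m => inp.getD (1 + m) 0).trans =
      S.trans N fun m => inp.getD (1 + m) 0 := rfl
  have hnumStates :
      (S.toLabelledVASS N fun m => inp.getD (1 + m) 0).numStates = S.numStates N := rfl
  have hcode (s : State ℕ) : (S.toLabelledVASS N fun m => inp.getD (1 + m) 0).code s =
      S.code (S.numIndices N) s := rfl
  have hI : N ^ (S.K + 3) = S.numIndices N := rfl
  simp only [genOutput, headerWords, bodyWords, List.map_append, List.map_cons, List.map_nil,
    List.map_replicate, hwords, htrans, hnumStates, hcode, hI, length_trans, eval_code,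
    Expr.eval_add, Expr.eval_mul, Expr.eval_natCast, Expr.eval_zero, Expr.eval_var,
    env_apply_three, State.map]
  simp only [trans, List.flatMap_append, List.flatMap_assoc, List.append_assoc, numStates]

theorem yes_inst_iff {d D K pad : ℕ} {hdD : d < D} (hdK : 3 ≤ d * K) {H : Hypergraph (Fin N)}
    (hV : H.vertexSet = Set.univ) (hU : H.IsUniform 3) {B : ℕ → ℕ}
    (hB : 0 < N → ((ofTriples d D K pad hdD).R * d + 1) * N ^ K ≤
      B ((ofTriples d D K pad hdD).toLabelledVASS N (tensor H)).size) :
    (boundedReachability D B).Yes ((ofTriples d D K pad hdD).inst B N (tensor H)) ↔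
      H.HasHyperclique 3 (d * K) := by
  have hcard : Fintype.card (Fin d × Fin K) = d * K := by simp
  rw [← hcard] at hdK ⊢
  rw [hasHyperclique_iff_exists_forall_range_mem hV hU (by norm_num) hdK]
  refine (LabelledVASS.yes_inst_iff B (Nat.zero_le _ : IsState N (check 0))
    (le_rfl : (ofTriples d D K pad hdD).IsState N (check _))).trans ⟨fun h => ?_, ?_⟩
  · obtain ⟨c, hc⟩ := exists_check_of_reachable h
    have hN : 0 < N := by
      refine Nat.pos_of_ne_zero ?_
      rintro rfl
      exact absurd (hc 0 (ofTriples_R_pos (by simpa using hdK)))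
        (by simp [Check, tensor, Hypergraph.encode3])
    exact ⟨fun p => ⟨vertex N c (Prod.map Fin.val Fin.val p), Nat.mod_lt _ hN⟩,
      (forall_check_iff fun _ => rfl).1 hc⟩
  · rintro ⟨v, hv⟩
    have hN : 0 < N := by
      have : Nonempty (Fin d × Fin K) := Fintype.card_pos_iff.1 (by omega)
      exact (v this.some).pos
    obtain ⟨c, hcK, hc⟩ := exists_bounded_check_of_range_mem (hdD := hdD) (pad := pad) hv
    have hsum : (ofTriples d D K pad hdD).sum c ≤ d * N ^ K := by
      refine (Finset.sum_le_card_nsmul (Finset.range d) c _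
        fun j hj => (hcK j (Finset.mem_range.1 hj)).le).trans_eq ?_
      rw [Finset.card_range, smul_eq_mul]
    have hB := hB hN
    rw [add_one_mul, mul_assoc] at hB
    have := Nat.mul_le_mul_left (ofTriples d D K pad hdD).R hsum
    refine reach_of_check hN hcK ⟨fun j hj => ?_, ?_⟩ hc
    · exact (hcK j hj).le.trans ((Nat.le_add_left _ _).trans hB)
    · exact this.trans ((Nat.le_add_right _ _).trans hB)

end Shape

theorem log_mul_pow_add_lt {q : ℕ} (hq : q ≠ 0) (N a b : ℕ) :
    Nat.log 2 (a * N ^ q + b) < (a + b + q) * (Nat.log 2 N + 1) := by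
  refine Nat.log_lt_of_lt_pow' (by positivity) ?_
  have hN : N ^ q ≤ 2 ^ (q * (Nat.log 2 N + 1)) := by
    rw [mul_comm, pow_mul]
    exact Nat.pow_le_pow_left (Nat.lt_pow_succ_log_self one_lt_two N).le q
  calc a * N ^ q + b ≤ (a + b) * 2 ^ (q * (Nat.log 2 N + 1)) := by
        rw [add_mul]
        exact Nat.add_le_add (Nat.mul_le_mul_left a hN)
          (Nat.le_mul_of_pos_right b (Nat.two_pow_pos _))
    _ < 2 ^ ((a + b) * (Nat.log 2 N + 1)) * 2 ^ (q * (Nat.log 2 N + 1)) := by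
        refine Nat.mul_lt_mul_of_pos_right (Nat.lt_two_pow_self.trans_le ?_) (Nat.two_pow_pos _)
        exact Nat.pow_le_pow_right two_pos (Nat.le_mul_of_pos_right _ (Nat.succ_pos _))
    _ = 2 ^ ((a + b + q) * (Nat.log 2 N + 1)) := by rw [← pow_add, ← add_mul]

open WordRAM in
theorem decidableInTime_hypercliqueProblem {d D K pad : ℕ} (hdD : d < D) (hdK : 3 ≤ d * K)
    {B T : ℕ → ℕ}
    (hB : ∀ x n, 0 < x → pad * x ≤ n →
      (Fintype.card (Fin 3 ↪ Fin d × Fin K) * d + 1) * x ≤ B n)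
    (h : (boundedReachability D B).DecidableInTime T) :
    ∃ a b k : ℕ, 0 < a ∧ (hypercliqueProblem (d * K)).DecidableInTime
      fun N => k * (N ^ (K + 3) + 1) + T (a * N ^ (K + 3) + b) := by
  obtain ⟨P, l, hP⟩ := h
  let S := Shape.ofTriples d D K pad hdD
  obtain ⟨A, l', k, hA⟩ := exists_generator (q := K + 3) (header := S.headerWords)
    (body := S.bodyWords) (by omega) (by simp [Shape.headerWords])
    (S.length_bodyWords_pos (Shape.ofTriples_R_pos hdK))
  let a := S.R * (2 * d + 1) + 1 + pad + S.bodyRules.length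
  let b := 2 * S.R + 2 + S.headerRules.length
  refine ⟨a, b, k, by omega, A ++ P.map (Instr.shift A.length),
    l' + l * (a + b + (K + 3)) + 4, ?_⟩
  rintro ⟨N, H, hV, hU⟩
  set w := (l' + l * (a + b + (K + 3)) + 4) * (Nat.log 2 N + 1)
  have hinput := genInput_encode3 H
  have hw4 : 4 * (Nat.log 2 N + 1) ≤ w := Nat.mul_le_mul_right _ (by omega)
  obtain ⟨t, ht, hwrite⟩ := hA N H.encode3 hinput w (Nat.mul_le_mul_right _ (by omega))
  obtain ⟨t', ht', out, hout, hyes⟩ := hP (S.inst B N (tensor H))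
  have hsize : (S.toLabelledVASS N (tensor H)).size = a * N ^ (K + 3) + b := S.size_toLabelledVASS
  have hsize_inst : (boundedReachability D B).size (S.inst B N (tensor H)) = a * N ^ (K + 3) + b :=
    (LabelledVASS.size_inst ..).trans hsize
  rw [Shape.yes_inst_iff hdK hV hU fun hN => hB _ _ (pow_pos hN K) (S.pad_mul_le_size hN)] at hyes
  rw [hsize_inst] at ht' hout
  have hww : l * (Nat.log 2 (a * N ^ (K + 3) + b) + 1) ≤ w := by
    refine (Nat.mul_le_mul_left l (log_mul_pow_add_lt (by omega) N a b)).trans ?_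
    rw [← mul_assoc]
    exact Nat.mul_le_mul_right _ (by omega)
  refine ⟨t + t', Nat.add_le_add ht ht', out, ?_, hyes⟩
  exact Outputs.comp hww (hinput.length_lt hw4) (hinput.lt_of_mem hw4)
    (S.genOutput_eq_encode B _ ▸ hwrite) hout

/-! ### Asymptotics of the reduction -/

theorem isLittleO_natCast_rpow_of_lt {p q : ℝ} (h : p < q) :
    (fun n : ℕ => (n : ℝ) ^ p) =o[atTop] fun n : ℕ => (n : ℝ) ^ q := by
  have hreal : (fun x : ℝ => x ^ p) =o[atTop] fun x : ℝ => x ^ q := by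
    refine isLittleO_of_tendsto' ?_
      ((tendsto_rpow_neg_atTop (sub_pos.2 h)).congr' ?_) <;>
      filter_upwards [eventually_gt_atTop 0] with x hx
    · exact fun h0 => absurd h0 (Real.rpow_pos_of_pos hx q).ne'
    · rw [neg_sub, Real.rpow_sub hx]
  exact hreal.comp_tendsto tendsto_natCast_atTop_atTop

theorem isBigO_natCast_rpow_of_le {p q : ℝ} (h : p ≤ q) :
    (fun n : ℕ => (n : ℝ) ^ p) =O[atTop] fun n : ℕ => (n : ℝ) ^ q := by
  rcases h.lt_or_eq with h | rfl
  · exact (isLittleO_natCast_rpow_of_lt h).isBigO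
  · exact isBigO_refl _ _

theorem isBigO_natCast_mul_pow_add_one (k q : ℕ) :
    (fun n : ℕ => ((k * (n ^ q + 1) : ℕ) : ℝ)) =O[atTop] fun n : ℕ => (n : ℝ) ^ q := by
  have hone : (fun _ : ℕ => (1 : ℝ)) =O[atTop] fun n : ℕ => (n : ℝ) ^ q := by
    simpa only [Real.rpow_zero, Real.rpow_natCast] using isBigO_natCast_rpow_of_le q.cast_nonneg
  push_cast
  exact ((isBigO_refl _ _).add hone).const_mul_left _

theorem isBigO_comp_mul_pow_add {T : ℕ → ℕ} {a q : ℕ} (b : ℕ) {e : ℝ} (ha : 0 < a) (hq : q ≠ 0)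
    (he : 0 ≤ e) (hT : (fun n : ℕ => (T n : ℝ)) =O[atTop] fun n : ℕ => (n : ℝ) ^ e) :
    (fun n : ℕ => (T (a * n ^ q + b) : ℝ)) =O[atTop] fun n : ℕ => (n : ℝ) ^ (q * e) := by
  have htend : Tendsto (fun n : ℕ => a * n ^ q + b) atTop atTop :=
    tendsto_atTop_mono (fun n => (Nat.le_self_pow hq n).trans
      ((Nat.le_mul_of_pos_left _ ha).trans (Nat.le_add_right _ b))) tendsto_id
  have hpow : (fun n : ℕ => ((a * n ^ q + b : ℕ) : ℝ)) =O[atTop] fun n : ℕ => (n : ℝ) ^ q := by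
    have hle (n : ℕ) : a * n ^ q + b ≤ (a + b) * (n ^ q + 1) :=
      (Nat.add_le_add (Nat.mul_le_mul (Nat.le_add_right a b) le_rfl) (Nat.le_add_left b a)).trans_eq
        (mul_add_one _ _).symm
    refine (isBigO_of_le _ fun n => ?_).trans (isBigO_natCast_mul_pow_add_one (a + b) q)
    simpa only [Real.norm_natCast] using Nat.cast_le.2 (hle n)
  simp only [Real.rpow_natCast_mul (Nat.cast_nonneg _)]
  exact (hT.comp_tendsto htend).trans
    (hpow.rpow he (Eventually.of_forall fun n => pow_nonneg n.cast_nonneg q))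

theorem exists_mul_le_of_isBigO {B : ℕ → ℕ}
    (hB : (fun n : ℕ => (n : ℝ)) =O[atTop] fun n : ℕ => (B n : ℝ)) (r : ℕ) :
    ∃ pad : ℕ, ∀ x n, 0 < x → pad * x ≤ n → r * x ≤ B n := by
  obtain ⟨C, hC, hCB⟩ := hB.exists_pos
  obtain ⟨n₀, hn₀⟩ := eventually_atTop.1 hCB.bound
  refine ⟨max n₀ ⌈C * r⌉₊, fun x n hx hn => ?_⟩
  have hbound := hn₀ n ((le_max_left _ _).trans ((Nat.le_mul_of_pos_right _ hx).trans hn))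
  rw [Real.norm_natCast, Real.norm_natCast] at hbound
  have hceil : ⌈C * r⌉₊ * x ≤ n := (Nat.mul_le_mul_right x (le_max_right _ _)).trans hn
  have hCr : C * (r * x : ℕ) ≤ C * B n := by
    calc C * (r * x : ℕ) = C * r * x := by push_cast; ring
      _ ≤ ⌈C * r⌉₊ * x := mul_le_mul_of_nonneg_right (Nat.le_ceil _) x.cast_nonneg
      _ ≤ n := by exact_mod_cast hceil
      _ ≤ C * B n := hbound
  exact Nat.cast_le.1 (le_of_mul_le_mul_left hCr hC)

theorem isBigO_natCast_natFloor_mul {γ : ℝ} (hγ : 0 < γ) :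
    (fun n : ℕ => (n : ℝ)) =O[atTop] fun n : ℕ => (⌊γ * (n : ℝ)⌋₊ : ℝ) := by
  have hfloor : (fun x : ℝ => x) =O[atTop] fun x : ℝ => (⌊x⌋₊ : ℝ) :=
    isEquivalent_nat_floor.isBigO_symm
  exact (isBigO_self_const_mul hγ.ne' _ _).trans
    (hfloor.comp_tendsto (tendsto_natCast_atTop_atTop.const_mul_atTop hγ))

/-! ### The lower bound -/

theorem not_decidableInTime_boundedReachability (hyp : HypercliqueHypothesis) {d D : ℕ}
    (hd : 2 ≤ d) (hdD : d < D) {B : ℕ → ℕ}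
    (hB : (fun n : ℕ => (n : ℝ)) =O[atTop] fun n : ℕ => (B n : ℝ)) {ε : ℝ} (hε : 0 < ε)
    (hε1 : ε ≤ 1) {T : ℕ → ℕ}
    (hT : (fun n : ℕ => (T n : ℝ)) =O[atTop] fun n : ℕ => (n : ℝ) ^ ((d : ℝ) - ε)) :
    ¬ (boundedReachability D B).DecidableInTime T := by
  intro hdec
  obtain ⟨K, hK⟩ := exists_nat_ge (max 4 ((3 * d + 1) / ε))
  have hd' : (2 : ℝ) ≤ d := by exact_mod_cast hd
  have hK4 : (4 : ℝ) ≤ K := (le_max_left _ _).trans hK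
  have hKε : 3 * (d : ℝ) + 1 ≤ K * ε := (div_le_iff₀ hε).1 ((le_max_right _ _).trans hK)
  have hdK : 3 ≤ d * K := by
    have : 4 ≤ K := by exact_mod_cast hK4
    nlinarith
  obtain ⟨pad, hpad⟩ := exists_mul_le_of_isBigO hB (Fintype.card (Fin 3 ↪ Fin d × Fin K) * d + 1)
  obtain ⟨a, b, k, ha, hclique⟩ := decidableInTime_hypercliqueProblem hdD hdK hpad hdec
  refine hyp (d * K) hdK 1 one_pos _ ?_ hclique
  have hwriteExp : ((K + 3 : ℕ) : ℝ) ≤ ((d * K : ℕ) : ℝ) - 1 := by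
    push_cast
    nlinarith
  have hreachExp : ((K + 3 : ℕ) : ℝ) * (d - ε) ≤ ((d * K : ℕ) : ℝ) - 1 := by
    push_cast
    nlinarith
  have hwrite := isBigO_natCast_mul_pow_add_one k (K + 3)
  simp only [← Real.rpow_natCast] at hwrite
  have hreach := isBigO_comp_mul_pow_add b ha (K + 2).succ_ne_zero (by linarith) hT
  have htotal := (hwrite.trans (isBigO_natCast_rpow_of_le hwriteExp)).add
    (hreach.trans (isBigO_natCast_rpow_of_le hreachExp))
  simpa only [Nat.cast_add] using htotal

theorem mainTheorem5_general (hyp : HypercliqueHypothesis) {d D : ℕ} (hdD : d < D) {B : ℕ → ℕ}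
    (hB : (fun n : ℕ => (n : ℝ)) =O[atTop] fun n : ℕ => (B n : ℝ)) :
    (boundedReachability D B).RequiresTimePow (d : ℝ) := by
  intro ε hε T hT
  rcases Nat.lt_or_ge d 2 with hd | hd
  · have hd1 : (d : ℝ) ≤ 1 := by exact_mod_cast Nat.le_of_lt_succ hd
    refine not_decidableInTime_boundedReachability_of_isLittleO D B (hT.trans_isLittleO ?_)
    simpa only [Real.rpow_one] using
      isLittleO_natCast_rpow_of_lt (show (d : ℝ) - ε < 1 by linarith)
  · refine not_decidableInTime_boundedReachability hyp hd hdD hB (lt_min hε one_pos)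
      (min_le_right ε 1) (hT.trans (isBigO_natCast_rpow_of_le ?_))
    exact sub_le_sub_left (min_le_left ε 1) _

theorem mainTheorem5 (hyp : HypercliqueHypothesis) (d : ℕ) (γ : ℝ) (hγ : 0 < γ) :
    (boundedReachability (d + 2) (fun n => ⌊γ * (n : ℝ)⌋₊)).RequiresTimePow (d : ℝ) :=
  mainTheorem5_general hyp (by omega) (isBigO_natCast_natFloor_mul hγ)
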